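/- **Parameters and paths.** A *parameter* is a totally ordered commutative monoid $(\Lambda,<,+,0)$ such that $\lambda_1<\lambda_2\iff\lambda_1+\lambda_3<\lambda_2+\lambda_3$, such that $\lambda_1<\lambda_2$ implies $\lambda_1+\lambda_3=\lambda_2$ for some $\lambda_3$, which has an element $>0$, and in which every non-empty subset that is bounded above has a least upper bound. A *path* is a function $\bar p$ on $\Lambda$; $\bar p[x_1,x_2]$ is its restriction to $[x_1,x_2]$ ($x_1=-\infty$, $x_2=\infty$ allowed). For sets $A,B$ of partial paths, $A\circ B$ is the set of all $\bar p_1[x_1,\lambda]\circ\bar p_2[\lambda,x_2]$ (glued at $\lambda$) with $\bar p_1[x_1,\lambda]\in A$, $\bar p_2[\lambda,x_2]\in B$, $\bar p_1(\lambda)=\bar p_2(\lambda)$. For a set $A$ of paths or partial paths, $A[x_1,x_2]$ is the set of restrictions to $[x_1,x_2]$ of those members that are defined on all of $[x_1,x_2]$. A *dynamic set* $S$ is a non-empty set of paths with common parameter $\Lambda_S$; $\mathcal P_S$ is the set of values (states) of its paths. It is a *dynamic space* if $\bar p,\bar p'\in S$, $\bar p(\lambda)=\bar p'(\lambda)$ imply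 $\bar p[-\infty,\lambda]\circ\bar p'[\lambda,\infty]\in S$. It is *homogeneous* if, whenever $\lambda_1\le\lambda_2$ and a state $p$ is attained by paths of $S$ at $\lambda_1$ and at $\lambda_2$, a path $\bar p$ is in $S$ with $\bar p(\lambda_1)=p$ if and only if there is $\bar p'\in S$ with $\bar p'(\lambda_2)=p$ and $\bar p(\lambda)=\bar p'(\lambda+\lambda_2-\lambda_1)$ for all $\lambda$. A set of states is *homogeneously realized* if each of its members is attained at every $\lambda$. For a set $A$ of partial paths, $+A$ is the set of all paths in $S$ that extend a member of $A$. A *covering* of $S$ is a set $K$ of subsets of $S$ with $\bigcup K=S$; it is a *partition* if it is also pairwise disjoint. **Shells.** A *shell* is a triple $(D,I,F)$ with $D$ a homogeneous dynamic space and $I,F\subset\mathcal P_D$, $I$ homogeneously realized, such that (i) whenever $\bar p\in D$ and $\bar p(\lambda)\in I$ there is $\lambda'\ge\lambda$ with $\bar p(\lambda')\in F$ and $\bar p\notin I$ on $(\lambda,\lambda']$; (ii) whenever $\bar p\in D$ and $\bar p(\lambda)\in F$ there is $\lambda'\le\lambda$ with $\bar p(\lambda')\in I$ and $\bar p\notin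 I$ on $(\lambda',\lambda]$. Its interior $Int$ is the set of states $\bar p(\lambda_2)$ with $\bar p\in D$, $\lambda_1\le\lambda_2$, $\bar p(\lambda_1)\in I$ and $\bar p\notin F$ on $[\lambda_1,\lambda_2)$; $Dom=F\cup Int$. It is an *environmental shell* if, with $\mathcal S$ the set of first components of pairs in $Dom$, and $\mathcal E_{Int}$, $\mathcal E_F$ the sets of second components of pairs in $Int$ and in $F$, one has $(\mathcal S\times\mathcal E_{Int})\cap\mathcal P_D=Int$ and $(\mathcal S\times\mathcal E_F)\cap\mathcal P_D=F$. (States outside $Dom$ need not be pairs.) For a partial path $\sigma$ of $D$, $\sigma\cdot\mathcal S$ and $\sigma\cdot\mathcal E$ are its first and second components, defined at the times at which the state is a pair. For $\lambda\in\Lambda_D$ and $A\subset Dom$ let $\omega^\lambda_A$ be the set of $\bar p[\lambda,\lambda']$ with $\bar p\in D$, $\lambda\le\lambda'$, $\bar p(\lambda)\in I$, $\bar p(\lambda')\in A$, $\bar p\notin I$ on $(\lambda,\lambda']$. Let $\Theta^\lambda_A$ (for $A\subset F$) be the set of $\bar p[\lambda,\lambda']$ with $\bar p\in D$, $\bar p(\lambda)\in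 I$, $\lambda'=\inf\{t\ge\lambda:\bar p(t)\in F\}$ (this set of times being non-empty), that are restrictions of members of $\omega^\lambda_A$. For $X\subset\mathcal E_F$ let $\mathcal O^\lambda_X=\{\sigma\cdot\mathcal S:\sigma\in\Theta^\lambda_{(\mathcal S\times X)\cap F}\}$. Write $\omega,\Theta,\mathcal O$ for $\lambda=0$, $\mathcal O_F=\mathcal O_{\mathcal E_F}$, $\mathcal O_e=\mathcal O_{\{e\}}$, $\mathcal O^\lambda_e=\mathcal O^\lambda_{\{e\}}$, $\omega_e=\omega_{(\mathcal S\times\{e\})\cap F}$. For $p\in Int$, $\Sigma_p$ (resp. $\Sigma_{p\to}$) is the set of $\bar p[0,\lambda_1]\cdot\mathcal S$ (resp. $\bar p[\lambda_1,\lambda_2]\cdot\mathcal S$) with $\bar p[0,\lambda_2]\in\Theta_F$, $0\le\lambda_1\le\lambda_2$, $\bar p(\lambda_1)=p$. **Ideal e-automata.** Let $|\mathcal O_e[0,\lambda]|=\bigcup_n|\mathcal O_e[0,\lambda]|_n$, where $|\mathcal O_e[0,\lambda]|_0=\mathcal O_e[0,\lambda]$ and $|\mathcal O_e[0,\lambda]|_{n+1}$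 is the union of those $\mathcal O_{e'}[0,\lambda]$, $e'\in\mathcal E_F$, that meet $|\mathcal O_e[0,\lambda]|_n$. States $p,p'\in Int$ are *undifferentiated* if for some $e\in\mathcal E_F$, $\lambda\ge0$, both $\Sigma_p$ and $\Sigma_{p'}$ meet $|\mathcal O_e[0,\lambda]|$. An environmental shell is: - *weakly unbiased* if for all $\lambda$ and all undifferentiated $(s,e_1),(s,e_2)$ that are values at $\lambda$ of members of $\Theta_F$, for every $\bar s_1[\lambda,\lambda_1]\in\Sigma_{(s,e_1)\to}$ there is $\bar s_2[\lambda,\lambda_2]\in\Sigma_{(s,e_2)\to}$ that agrees with it on $[\lambda,\min(\lambda_1,\lambda_2)]$; - said to satisfy the *automata condition* if $\bar s_1[0,\lambda_1],\bar s_2[0,\lambda_2]\in\mathcal O_F$ and $\lambda_1<\lambda_2$ imply $\bar s_1[0,\lambda_1]\ne\bar s_2[0,\lambda_1]$; - *boolean* if for $e,e'\in\mathcal E_F$ either $\mathcal O_e=\mathcal O_{e'}$ or $\mathcal O_e\cap\mathcal O_{e'}=\emptyset$; - *all-reet* (all-retaining) if for every $e\in\mathcal E_F$ and every $\bar e\in\omega_e\cdot\mathcal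 E$ one has $\mathcal O_{\bar e}=\mathcal O_e$, where $\mathcal O_{\bar e}$ is the set of $\sigma\cdot\mathcal S$ with $\sigma\in\Theta_F$ a restriction of some $\rho\in\omega_{Dom}$ with $\rho\cdot\mathcal E=\bar e$. An *ideal e-automaton* is an environmental shell with these four properties. **Ideal partitions.** For a covering $K$ of $S$, $\alpha\in K$, $\lambda\in\Lambda_S$, let $|\alpha[-\infty,\lambda]|=\bigcup_n|\alpha[-\infty,\lambda]|_n$, where $|\alpha[-\infty,\lambda]|_0=\alpha[-\infty,\lambda]$ and $|\alpha[-\infty,\lambda]|_{n+1}$ is the union of those $\beta[-\infty,\lambda]$, $\beta\in K$, that meet $|\alpha[-\infty,\lambda]|_n$. A set $\alpha\subset S$ is *bounded from below by $\lambda$* if $\alpha=S[-\infty,\lambda]\circ\alpha[\lambda,\infty]$, *bounded from above by $\lambda$* if $\alpha=\alpha[-\infty,\lambda]\circ S[\lambda,\infty]$, *strongly bounded from below by $\lambda$* if it is bounded from below by every $\lambda'\le\lambda$, and *weakly bounded from above by $\lambda$* if $\alpha=+(\alpha[-\infty,\lambda])$. A partition $K$ of a dynamic set $S$ is an *ideal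 partition* if all its members are strongly bounded from below by one common $\lambda$, each $\alpha\in K$ is weakly bounded from above by some $\lambda$, and $\alpha=|\alpha[-\infty,\lambda]|\circ\alpha[\lambda,\infty]$ for all $\alpha\in K$, $\lambda\in\Lambda_S$. A partition $K$ of a dynamic space is an *ideal partition of the dynamic space* if the same holds with "bounded from below" and "bounded from above" in place of "strongly bounded from below" and "weakly bounded from above". **Deciding.** Let $Z=(D_Z,I,F)$ be an ideal e-automaton. A covering $K$ of a dynamic set $S$ is *decided* by $Z$ if $\Lambda_S=\Lambda_{D_Z}$ and for some $\lambda\in\Lambda_S$: (1) every $\bar s[\lambda,\lambda']\in\mathcal O^\lambda_F$ is in $S[\lambda,\lambda']$; (2) $S$ is strongly bounded from below by $\lambda$ (as a subset of itself), and for all $\alpha\in K$, $\lambda'>\lambda$, $\bar p_1,\bar p_2\in+|\alpha[-\infty,\lambda']|$ with $\bar p_1(\lambda')=\bar p_2(\lambda')$ one has $\bar p_1[-\infty,\lambda']\circ\bar p_2[\lambda',\infty]\in S$; (3) $K=\{+\mathcal O^\lambda_e:e\in\mathcal E_F\}$. A covering $K$ of a dynamic space $S$ is *decided, as a covering of a dynamic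 space,* by $Z$ if $\Lambda_S=\Lambda_{D_Z}$ and $K=\{+\mathcal O^\lambda_e:e\in\mathcal E_F\}$ for some $\lambda\in\Lambda_S$. **Theorem.** Let $Z$ be an ideal e-automaton. (a) If a covering $K$ of a dynamic set $S$ is decided by $Z$, then $K$ is an ideal partition of $S$. (b) If a covering $K$ of a dynamic space $S$ is decided by $Z$ as a covering of a dynamic space, then $K$ is an ideal partition of the dynamic space $S$. -/

import Mathlib

open Set

namespace DynExp

/-- A parameter: a totally ordered commutative monoid `(Λ, <, +, 0)` whose order is translation
invariant (in both directions), in which `a ≤ b` implies `a + c = b` for some `c`, which has a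
positive element, and in which every non-empty set that is bounded above has a least upper
bound. -/
class IsParameter (Λ : Type*) [AddCommMonoid Λ] [LinearOrder Λ] : Prop extends
    IsOrderedCancelAddMonoid Λ, ExistsAddOfLE Λ where
  exists_pos : ∃ l : Λ, 0 < l
  exists_isLUB : ∀ s : Set Λ, s.Nonempty → BddAbove s → ∃ l, IsLUB s l

/-! ### Partial paths -/

/-- Partial functions on `Λ`; a path `p : Λ → X` restricted to an interval is of this kind. -/
abbrev Seg (Λ X : Type*) := Λ → Option X

section Segments

variable {Λ X : Type*}

/-- The domain of a partial path. -/
def Seg.dom (σ : Seg Λ X) : Set Λ := {t | ∃ x, σ t = some x}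

open Classical in
/-- The restriction of a partial path to the times in `A`. -/
noncomputable def Seg.restrict (σ : Seg Λ X) (A : Set Λ) : Seg Λ X :=
  fun t => if t ∈ A then σ t else none

/-- The partial path `σ` is a restriction of `ρ`. -/
def Seg.IsPartOf (σ ρ : Seg Λ X) : Prop := ∀ t ∈ σ.dom, ρ t = σ t

/-- A path, seen as a partial path with domain `Λ`. -/
def total (p : Λ → X) : Seg Λ X := fun t => some (p t)

/-- `p[x₁,x₂]`, where `A` is the interval `[x₁,x₂]`. The intervals `[-∞,l]` and `[l,∞]` are
`Iic l` and `Ici l`. -/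
noncomputable def cut (p : Λ → X) (A : Set Λ) : Seg Λ X := (total p).restrict A

/-- `S[x₁,x₂]` for a set `S` of paths, where `A` is the interval `[x₁,x₂]`. -/
def cuts (S : Set (Λ → X)) (A : Set Λ) : Set (Seg Λ X) := (fun p => cut p A) '' S

/-- `O[x₁,x₂]` for a set `O` of partial paths, where `A` is the interval `[x₁,x₂]`: only the
members of `O` that are defined on all of `A` contribute. -/
def restrictAll (O : Set (Seg Λ X)) (A : Set Λ) : Set (Seg Λ X) :=
  {τ | ∃ σ ∈ O, A ⊆ σ.dom ∧ τ = σ.restrict A}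

/-- The concatenation `A ∘ B` of two sets of partial paths: the members `p₁[x₁,l]` of `A` and
`p₂[l,x₂]` of `B` with `p₁(l) = p₂(l)` are joined. -/
def concat [LinearOrder Λ] (A B : Set (Seg Λ X)) : Set (Seg Λ X) :=
  {ρ | ∃ σ ∈ A, ∃ τ ∈ B, ∃ l, IsGreatest σ.dom l ∧ IsLeast τ.dom l ∧ σ l = τ l ∧
    ρ = fun t => (σ t).or (τ t)}

/-- The path `p₁[-∞,l] ∘ p₂[l,∞]`, used only when `p₁ l = p₂ l`. -/
def splice [LinearOrder Λ] (l : Λ) (p₁ p₂ : Λ → X) : Λ → X :=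
  fun t => if t ≤ l then p₁ t else p₂ t

/-- `chain G A n`: start with `A`, and at each step take the union of all members of the family
`G` that meet the set obtained so far. -/
def chain (G : Set (Set (Seg Λ X))) (A : Set (Seg Λ X)) : ℕ → Set (Seg Λ X)
  | 0 => A
  | n + 1 => {σ | ∃ B ∈ G, (B ∩ chain G A n).Nonempty ∧ σ ∈ B}

/-- The union of all `chain G A n`. -/
def chainUnion (G : Set (Set (Seg Λ X))) (A : Set (Seg Λ X)) : Set (Seg Λ X) :=
  ⋃ n, chain G A n

end Segments

/-! ### Dynamic sets and dynamic spaces -/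

section Dynamics

variable {Λ X : Type*}

/-- A dynamic set is a non-empty set of paths with a common parameter `Λ`. -/
def IsDynamicSet (S : Set (Λ → X)) : Prop := S.Nonempty

/-- The set of states that occur in `S`. -/
def states (S : Set (Λ → X)) : Set X := {x | ∃ p ∈ S, ∃ l, p l = x}

/-- `S(l)`, the set of states that can occur at `l`. -/
def statesAt (S : Set (Λ → X)) (l : Λ) : Set X := {x | ∃ p ∈ S, p l = x}

/-- The paths of `S` that extend some member of `A`. For a dynamic space this is `→A→`; for a
dynamic set it is the part of `→A→` that lies in `S`, written `+A`. If the members of `A` are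
defined on intervals `[-∞,l]`, it is also the part of `A→` that lies in `S`. -/
def through (S : Set (Λ → X)) (A : Set (Seg Λ X)) : Set (Λ → X) :=
  {p | p ∈ S ∧ ∃ σ ∈ A, σ.IsPartOf (total p)}

/-- `K` is a covering of `S`. -/
def IsCovering (S : Set (Λ → X)) (K : Set (Set (Λ → X))) : Prop := ⋃₀ K = S

/-- `K` is a partition of `S`. -/
def IsPartition (S : Set (Λ → X)) (K : Set (Set (Λ → X))) : Prop :=
  IsCovering S K ∧ ∀ α ∈ K, ∀ β ∈ K, α ≠ β → Disjoint α β

variable [LinearOrder Λ]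

/-- A dynamic space is a dynamic set that is closed under concatenation. -/
def IsDynamicSpace (D : Set (Λ → X)) : Prop :=
  IsDynamicSet D ∧ ∀ p₁ ∈ D, ∀ p₂ ∈ D, ∀ l, p₁ l = p₂ l → splice l p₁ p₂ ∈ D

/-- Homogeneity: for `l ≤ l + δ` and a state `x` possible at both times, the paths through `x`
at `l` are exactly the shifts by `δ` of the paths through `x` at `l + δ`. -/
def IsHomogeneous [AddCommMonoid Λ] (S : Set (Λ → X)) : Prop :=
  ∀ (l δ : Λ) (x : X), 0 ≤ δ → x ∈ statesAt S l → x ∈ statesAt S (l + δ) →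
    ∀ p : Λ → X, (p ∈ S ∧ p l = x) ↔ ∃ p' ∈ S, p' (l + δ) = x ∧ ∀ t, p t = p' (t + δ)

/-- Every member of `A` is a possible state at every time. -/
def IsHomogeneouslyRealized (S : Set (Λ → X)) (A : Set X) : Prop :=
  ∀ x ∈ A, ∀ l, x ∈ statesAt S l

/-- `S_{Y→}`. -/
def pathsFrom (S : Set (Λ → X)) (Y : Set X) : Set (Seg Λ X) :=
  {σ | ∃ p ∈ S, ∃ l, p l ∈ Y ∧ σ = cut p (Ici l)}

/-- `S_{→Y}`. -/
def pathsTo (S : Set (Λ → X)) (Y : Set X) : Set (Seg Λ X) :=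
  {σ | ∃ p ∈ S, ∃ l, p l ∈ Y ∧ σ = cut p (Iic l)}

/-- `S_{W↿Y→Z}`: the segments from `Y` to `Z` that do not enter `W` after their start. -/
def segsAvoidingAfter (S : Set (Λ → X)) (W Y Z : Set X) : Set (Seg Λ X) :=
  {σ | ∃ p ∈ S, ∃ l₁ l₂, l₁ ≤ l₂ ∧ p l₁ ∈ Y ∧ p l₂ ∈ Z ∧ (∀ t ∈ Ioc l₁ l₂, p t ∉ W) ∧
    σ = cut p (Icc l₁ l₂)}

/-- `S_{Y→Z↾W}`: the segments from `Y` to `Z` that do not enter `W` before their end. -/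
def segsAvoidingBefore (S : Set (Λ → X)) (Y Z W : Set X) : Set (Seg Λ X) :=
  {σ | ∃ p ∈ S, ∃ l₁ l₂, l₁ ≤ l₂ ∧ p l₁ ∈ Y ∧ p l₂ ∈ Z ∧ (∀ t ∈ Ico l₁ l₂, p t ∉ W) ∧
    σ = cut p (Icc l₁ l₂)}

/-- `S_{Y/Z}`: the segments that start in `Y` and end at the infimum of the times, from the
start on, at which the path is in `Z`. -/
def segsUntil (S : Set (Λ → X)) (Y Z : Set X) : Set (Seg Λ X) :=
  {σ | ∃ p ∈ S, ∃ l₁ l₂, p l₁ ∈ Y ∧ (∃ t, l₁ ≤ t ∧ p t ∈ Z) ∧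
    IsGLB {t | l₁ ≤ t ∧ p t ∈ Z} l₂ ∧ σ = cut p (Icc l₁ l₂)}

/-- `A→`, for a set `A` of partial paths defined on intervals `[l₁,l₂]`. -/
def extendRight (D : Set (Λ → X)) (A : Set (Seg Λ X)) : Set (Seg Λ X) :=
  {σ | ∃ p ∈ D, ∃ l₁ l₂, l₁ ≤ l₂ ∧ cut p (Icc l₁ l₂) ∈ A ∧ σ = cut p (Ici l₁)}

/-- `→A`, for a set `A` of partial paths defined on intervals `[l₁,l₂]`. -/
def extendLeft (D : Set (Λ → X)) (A : Set (Seg Λ X)) : Set (Seg Λ X) :=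
  {σ | ∃ p ∈ D, ∃ l₁ l₂, l₁ ≤ l₂ ∧ cut p (Icc l₁ l₂) ∈ A ∧ σ = cut p (Iic l₂)}

/-! ### Bounded sets and ideal partitions -/

/-- `α = S[-∞,l] ∘ α[l,∞]`: `α` is bounded from below by `l`. -/
def IsBoundedBelow (S α : Set (Λ → X)) (l : Λ) : Prop :=
  total '' α = concat (cuts S (Iic l)) (cuts α (Ici l))

/-- `α = α[-∞,l] ∘ S[l,∞]`: `α` is bounded from above by `l`. -/
def IsBoundedAbove (S α : Set (Λ → X)) (l : Λ) : Prop :=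
  total '' α = concat (cuts α (Iic l)) (cuts S (Ici l))

/-- `α = →α[l',∞]` for all `l' ≤ l`: `α` is strongly bounded from below by `l`. Here
`→α[l',∞]` is `S[-∞,l'] ∘ α[l',∞]`. -/
def IsStronglyBoundedBelow (S α : Set (Λ → X)) (l : Λ) : Prop :=
  ∀ l' ≤ l, IsBoundedBelow S α l'

/-- `α` is the set of all paths of `S` that extend a member of `α[-∞,l]`: `α` is weakly bounded
from above by `l`. -/
def IsWeaklyBoundedAbove (S α : Set (Λ → X)) (l : Λ) : Prop :=
  α = through S (cuts α (Iic l))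

/-- `|α[-∞,l]|`, formed with respect to the covering `K`. -/
def coarse (K : Set (Set (Λ → X))) (α : Set (Λ → X)) (l : Λ) : Set (Seg Λ X) :=
  chainUnion {B | ∃ β ∈ K, B = cuts β (Iic l)} (cuts α (Iic l))

/-- `α = |α[-∞,l]| ∘ α[l,∞]` for all `α ∈ K` and all `l`. -/
def Recombines (K : Set (Set (Λ → X))) : Prop :=
  ∀ α ∈ K, ∀ l, total '' α = concat (coarse K α l) (cuts α (Ici l))

/-- Ideal partitions of a dynamic set. -/
structure IsIdealPartition (S : Set (Λ → X)) (K : Set (Set (Λ → X))) : Prop where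
  partition : IsPartition S K
  below : ∃ l, ∀ α ∈ K, IsStronglyBoundedBelow S α l
  above : ∀ α ∈ K, ∃ l, IsWeaklyBoundedAbove S α l
  recombines : Recombines K

/-- Ideal partitions of a dynamic space. -/
structure IsSpaceIdealPartition (S : Set (Λ → X)) (K : Set (Set (Λ → X))) : Prop where
  partition : IsPartition S K
  below : ∃ l, ∀ α ∈ K, IsBoundedBelow S α l
  above : ∀ α ∈ K, ∃ l, IsBoundedAbove S α l
  recombines : Recombines K

/-- `S` is unbiased with respect to `(l, K)`. -/
structure IsUnbiased (S : Set (Λ → X)) (l : Λ) (K : Set (Set (Λ → X))) : Prop where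
  below : IsStronglyBoundedBelow S S l
  splice_mem : ∀ α ∈ K, ∀ l' > l, ∀ p₁ ∈ through S (coarse K α l'),
    ∀ p₂ ∈ through S (coarse K α l'), p₁ l' = p₂ l' → splice l' p₁ p₂ ∈ S

end Dynamics

/-! ### Shells and e-automata -/

/-- The data of an environmental shell `(D, I, F)`. The states of `D` have type `P`; the map
`pair` says which elements of `P` are pairs (system state, environmental state), so that states
outside the shell domain need not be pairs. -/
structure ShellData (Λ 𝒮 ℰ P : Type*) where
  pair : 𝒮 × ℰ ↪ P
  D : Set (Λ → P)
  I : Set P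
  F : Set P

namespace ShellData

variable {Λ 𝒮 ℰ P : Type*}

/-- The system component of a partial path, defined where the state is a pair. -/
noncomputable def sysPart (Z : ShellData Λ 𝒮 ℰ P) (σ : Seg Λ P) : Seg Λ 𝒮 :=
  fun t => ((σ t).bind (Function.partialInv Z.pair)).map Prod.fst

/-- The environmental component of a partial path, defined where the state is a pair. -/
noncomputable def envPart (Z : ShellData Λ 𝒮 ℰ P) (σ : Seg Λ P) : Seg Λ ℰ :=
  fun t => ((σ t).bind (Function.partialInv Z.pair)).map Prod.snd

variable [AddCommMonoid Λ] [LinearOrder Λ]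

/-- `(D, I, F)` is a shell. -/
structure IsShell (Z : ShellData Λ 𝒮 ℰ P) : Prop where
  dynamicSpace : IsDynamicSpace Z.D
  initial_subset : Z.I ⊆ states Z.D
  final_subset : Z.F ⊆ states Z.D
  homogeneous : IsHomogeneous Z.D
  realized : IsHomogeneouslyRealized Z.D Z.I
  from_initial : pathsFrom Z.D Z.I = extendRight Z.D (segsAvoidingAfter Z.D Z.I Z.I Z.F)
  to_final : pathsTo Z.D Z.F = extendLeft Z.D (segsAvoidingAfter Z.D Z.I Z.I Z.F)

/-- The shell interior. -/
def interior (Z : ShellData Λ 𝒮 ℰ P) : Set P :=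
  {x | x ∈ states Z.D ∧ (segsAvoidingBefore Z.D Z.I {x} Z.F).Nonempty}

/-- The shell domain. -/
def domain (Z : ShellData Λ 𝒮 ℰ P) : Set P := Z.F ∪ Z.interior

/-- The system: the first components of the shell domain. -/
def sys (Z : ShellData Λ 𝒮 ℰ P) : Set 𝒮 := {s | ∃ e, Z.pair (s, e) ∈ Z.domain}

/-- The second components of the shell interior. -/
def envInt (Z : ShellData Λ 𝒮 ℰ P) : Set ℰ := {e | ∃ s, Z.pair (s, e) ∈ Z.interior}

/-- The second components of the final states. -/
def envFin (Z : ShellData Λ 𝒮 ℰ P) : Set ℰ := {e | ∃ s, Z.pair (s, e) ∈ Z.F}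

/-- The set of pairs formed from system states and members of `E`. -/
def withEnv (Z : ShellData Λ 𝒮 ℰ P) (E : Set ℰ) : Set P := Z.pair '' (Z.sys ×ˢ E)

/-- Environmental shells. -/
structure IsEnvironmentalShell (Z : ShellData Λ 𝒮 ℰ P) : Prop where
  shell : Z.IsShell
  interior_eq : Z.withEnv Z.envInt ∩ states Z.D = Z.interior
  final_eq : Z.withEnv Z.envFin ∩ states Z.D = Z.F

/-- The segments of `I↿I→A` that start at `a`. For `a = 0` this is `ω_A`. -/
def omega (Z : ShellData Λ 𝒮 ℰ P) (a : Λ) (A : Set P) : Set (Seg Λ P) :=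
  {σ | σ ∈ segsAvoidingAfter Z.D Z.I Z.I A ∧ ∃ b, a ≤ b ∧ σ.dom = Icc a b}

/-- `Θ_A^a`; for `a = 0` this is `Θ_A`. -/
def theta (Z : ShellData Λ 𝒮 ℰ P) (a : Λ) (A : Set P) : Set (Seg Λ P) :=
  {σ | σ ∈ segsUntil Z.D Z.I Z.F ∧ (∃ b, a ≤ b ∧ σ.dom = Icc a b) ∧
    ∃ ρ ∈ Z.omega a A, σ.IsPartOf ρ}

/-- `𝒪_E^a`; for `a = 0` this is `𝒪_E`. -/
def outcome (Z : ShellData Λ 𝒮 ℰ P) (a : Λ) (E : Set ℰ) : Set (Seg Λ 𝒮) :=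
  Z.sysPart '' Z.theta a (Z.withEnv E)

/-- `Σ_A`: the system paths from the start of a run up to a visit to `A`. -/
def sigma (Z : ShellData Λ 𝒮 ℰ P) (A : Set P) : Set (Seg Λ 𝒮) :=
  {σ | ∃ ρ ∈ Z.theta 0 Z.F, ∃ t, ∃ x ∈ A, ρ t = some x ∧
    σ = Z.sysPart (ρ.restrict (Icc 0 t))}

/-- `Σ_{A→}`: the system paths from a visit to `A` up to the end of the run. -/
def sigmaFrom (Z : ShellData Λ 𝒮 ℰ P) (A : Set P) : Set (Seg Λ 𝒮) :=
  {σ | ∃ ρ ∈ Z.theta 0 Z.F, ∃ t, ∃ x ∈ A, ρ t = some x ∧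
    σ = Z.sysPart (ρ.restrict (Ici t))}

/-- The automata condition. -/
def AutomataCondition (Z : ShellData Λ 𝒮 ℰ P) : Prop :=
  ∀ σ₁ ∈ Z.outcome 0 Z.envFin, ∀ σ₂ ∈ Z.outcome 0 Z.envFin, ∀ l₁ l₂,
    σ₁.dom = Icc 0 l₁ → σ₂.dom = Icc 0 l₂ → l₁ < l₂ → σ₁ ≠ σ₂.restrict (Icc 0 l₁)

/-- `|𝒪_e[0,l]|`. -/
def coarseOutcome (Z : ShellData Λ 𝒮 ℰ P) (e : ℰ) (l : Λ) : Set (Seg Λ 𝒮) :=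
  chainUnion {B | ∃ e' ∈ Z.envFin, B = restrictAll (Z.outcome 0 {e'}) (Icc 0 l)}
    (restrictAll (Z.outcome 0 {e}) (Icc 0 l))

/-- The interior states `x` and `y` are undifferentiated. -/
def Undifferentiated (Z : ShellData Λ 𝒮 ℰ P) (x y : P) : Prop :=
  x ∈ Z.interior ∧ y ∈ Z.interior ∧ ∃ e ∈ Z.envFin, ∃ l, 0 ≤ l ∧
    (Z.sigma {x} ∩ Z.coarseOutcome e l).Nonempty ∧
    (Z.sigma {y} ∩ Z.coarseOutcome e l).Nonempty

/-- Weakly unbiased: if the states `(s, e₁)` and `(s, e₂)`, both possible at `l`, are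
undifferentiated, then every member of `Σ_{(s,e₁)→}` starting at `l` agrees with some member of
`Σ_{(s,e₂)→}` starting at `l` for as long as both last. (As `e₁` and `e₂` may be exchanged, the
condition is symmetric.) -/
def IsWeaklyUnbiased (Z : ShellData Λ 𝒮 ℰ P) : Prop :=
  ∀ (l : Λ) (s : 𝒮) (e₁ e₂ : ℰ),
    (∃ ρ ∈ Z.theta 0 Z.F, ρ l = some (Z.pair (s, e₁))) →
    (∃ ρ ∈ Z.theta 0 Z.F, ρ l = some (Z.pair (s, e₂))) →
    Z.Undifferentiated (Z.pair (s, e₁)) (Z.pair (s, e₂)) →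
    ∀ σ₁ ∈ Z.sigmaFrom {Z.pair (s, e₁)}, ∀ l₁, σ₁.dom = Icc l l₁ →
      ∃ σ₂ ∈ Z.sigmaFrom {Z.pair (s, e₂)}, ∃ l₂, σ₂.dom = Icc l l₂ ∧
        σ₁.restrict (Icc l (min l₁ l₂)) = σ₂.restrict (Icc l (min l₁ l₂))

/-- E-automata. -/
structure IsEAutomaton (Z : ShellData Λ 𝒮 ℰ P) : Prop where
  environmentalShell : Z.IsEnvironmentalShell
  weaklyUnbiased : Z.IsWeaklyUnbiased
  automataCondition : Z.AutomataCondition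

/-- Boolean: two outcomes are equal or disjoint. -/
def IsBoolean (Z : ShellData Λ 𝒮 ℰ P) : Prop :=
  ∀ e ∈ Z.envFin, ∀ e' ∈ Z.envFin,
    Z.outcome 0 {e} = Z.outcome 0 {e'} ∨ Disjoint (Z.outcome 0 {e}) (Z.outcome 0 {e'})

/-- `ω_ē` for an environmental path segment `ē`. -/
def omegaEnv (Z : ShellData Λ 𝒮 ℰ P) (ē : Seg Λ ℰ) : Set (Seg Λ P) :=
  {σ | σ ∈ Z.omega 0 Z.domain ∧ Z.envPart σ = ē}

/-- `𝒪_ē` for an environmental path segment `ē`: the system components of the members of `Θ_F`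
that are parts of members of `ω_ē`. -/
def outcomeEnv (Z : ShellData Λ 𝒮 ℰ P) (ē : Seg Λ ℰ) : Set (Seg Λ 𝒮) :=
  Z.sysPart '' {σ | σ ∈ Z.theta 0 Z.F ∧ ∃ ρ ∈ Z.omegaEnv ē, σ.IsPartOf ρ}

/-- All-reet (all-retaining): for every final environmental state `e` and every environmental
path segment `ē` along which `e` can be reached, `𝒪_ē = 𝒪_e`. -/
def IsAllReet (Z : ShellData Λ 𝒮 ℰ P) : Prop :=
  ∀ e ∈ Z.envFin, ∀ ē ∈ Z.envPart '' Z.omega 0 (Z.withEnv {e}),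
    Z.outcomeEnv ē = Z.outcome 0 {e}

/-- Ideal e-automata. -/
structure IsIdealEAutomaton (Z : ShellData Λ 𝒮 ℰ P) : Prop where
  eAutomaton : Z.IsEAutomaton
  boolean : Z.IsBoolean
  allReet : Z.IsAllReet

/-- The covering `K` of the dynamic set `S` is decided by the e-automaton `Z`. -/
def Decides (Z : ShellData Λ 𝒮 ℰ P) (S : Set (Λ → 𝒮)) (K : Set (Set (Λ → 𝒮))) : Prop :=
  ∃ l : Λ, (∀ σ ∈ Z.outcome l Z.envFin, ∀ l', σ.dom = Icc l l' → σ ∈ cuts S (Icc l l')) ∧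
    IsUnbiased S l K ∧ K = {α | ∃ e ∈ Z.envFin, α = through S (Z.outcome l {e})}

/-- The covering `K` of the dynamic space `S` is decided by the e-automaton `Z`. -/
def DecidesSpace (Z : ShellData Λ 𝒮 ℰ P) (S : Set (Λ → 𝒮)) (K : Set (Set (Λ → 𝒮))) : Prop :=
  ∃ l : Λ, K = {α | ∃ e ∈ Z.envFin, α = through S (Z.outcome l {e})}

end ShellData

end DynExp

namespace DynExp

/-! ### Cuts, splices and concatenation of paths -/

section Segments

variable {Λ X : Type*}

/-! By homogeneity outcomes may be shifted to time `0`. There they are the system components of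
runs: paths of the shell from an initial state to a final one, cut off at the infimum of their final
times.

Two rigidity facts give the partition and its boundedness. First, the automata condition forbids
that one outcome properly prolongs another, so outcomes that agree as long as both last coincide;
booleanness then makes the outcome sets of their final environments equal (`eq_of_eqOn`). Second, in
the shell domain finality can be read off from the environmental component. Since all-reetness lets
every outcome of `e` be realized with the environment of any given run to `e`, all outcomes of `e`
have the same duration (`duration_unique`), and the decision for `e` is visible at one fixed time.

The core is recombination: if the past of `q` lies in the coarse past of the class of `e`, and `r`
in that class meets `q` at time `m`, the path that follows `q` and then `r` must again have an
outcome of `e`. If `q` is decided by `m`, it is decided for the class of `e`. Otherwise it suffices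
to find runs for `q` and for `r` with the same environment up to `m`: they are then in the same
state at `m` and can be spliced in the shell. That such environments exist is `accompanies_of_eqOn`
for a single overlap of pasts: weak unbiasedness lets the future of one run be followed from the
state of the other, and the spliced run is forced into the desired class by `eq_of_eqOn`. Induction
along the chain of overlaps (`accompanies_of_mem_chain`) gives the general case. -/

theorem cut_of_mem {p : Λ → X} {A : Set Λ} {t : Λ} (h : t ∈ A) : cut p A t = some (p t) := by
  simp [cut, Seg.restrict, total, h]

theorem cut_of_notMem {p : Λ → X} {A : Set Λ} {t : Λ} (h : t ∉ A) : cut p A t = none := by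
  simp [cut, Seg.restrict, h]

theorem dom_cut (p : Λ → X) (A : Set Λ) : (cut p A).dom = A := by
  ext t
  by_cases h : t ∈ A <;> simp [Seg.dom, cut_of_mem, cut_of_notMem, h]

theorem cut_eq_cut_iff {p q : Λ → X} {A : Set Λ} : cut p A = cut q A ↔ ∀ t ∈ A, p t = q t := by
  constructor
  · intro h t ht
    have := congrFun h t
    rwa [cut_of_mem ht, cut_of_mem ht, Option.some_inj] at this
  · intro h
    funext t
    by_cases ht : t ∈ A
    · rw [cut_of_mem ht, cut_of_mem ht, h t ht]
    · rw [cut_of_notMem ht, cut_of_notMem ht]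

theorem restrict_cut (p : Λ → X) (A B : Set Λ) : (cut p A).restrict B = cut p (A ∩ B) := by
  funext t
  by_cases hA : t ∈ A <;> by_cases hB : t ∈ B <;> simp [cut, Seg.restrict, hA, hB]

theorem isPartOf_total_iff {σ : Seg Λ X} {p : Λ → X} {A : Set Λ} (h : σ.dom = A) :
    σ.IsPartOf (total p) ↔ σ = cut p A := by
  subst h
  constructor
  · intro hp
    funext t
    by_cases ht : t ∈ σ.dom
    · rw [cut_of_mem ht, ← hp t ht]; rfl
    · rw [cut_of_notMem ht]
      rw [Option.eq_none_iff_forall_ne_some]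
      exact fun x hx => ht ⟨x, hx⟩
  · intro hp t ht
    rw [hp, cut_of_mem ht]; rfl

theorem total_injective : Function.Injective (total : (Λ → X) → Seg Λ X) := fun p q h => by
  funext t
  exact Option.some_inj.1 (congrFun h t)

theorem mem_through_of_cut_mem {S : Set (Λ → X)} {A : Set (Seg Λ X)} {B : Set Λ} {p : Λ → X}
    (hp : p ∈ S) (h : cut p B ∈ A) : p ∈ through S A :=
  ⟨hp, _, h, (isPartOf_total_iff (dom_cut p B)).2 rfl⟩

variable [LinearOrder Λ]

theorem splice_of_le {l t : Λ} (p q : Λ → X) (h : t ≤ l) : splice l p q t = p t := if_pos h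

theorem splice_of_lt {l t : Λ} (p q : Λ → X) (h : l < t) : splice l p q t = q t :=
  if_neg h.not_ge

theorem splice_of_ge {l t : Λ} {p q : Λ → X} (hpq : p l = q l) (h : l ≤ t) :
    splice l p q t = q t := by
  rcases h.eq_or_lt with rfl | h
  · rw [splice_of_le _ _ le_rfl, hpq]
  · exact splice_of_lt _ _ h

theorem splice_self (l : Λ) (p : Λ → X) : splice l p p = p := by
  funext t; simp [splice]

/-- The domains `Iic l` and `Ici l` force the gluing time to be `l`, so concatenation of partial
paths becomes splicing of total ones. -/
theorem mem_concat_cuts_iff {A B : Set (Λ → X)} {l : Λ} {ρ : Seg Λ X} :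
    ρ ∈ concat (cuts A (Iic l)) (cuts B (Ici l)) ↔
      ∃ p ∈ A, ∃ q ∈ B, p l = q l ∧ ρ = total (splice l p q) := by
  have key : ∀ p q : Λ → X, p l = q l →
      (fun t => (cut p (Iic l) t).or (cut q (Ici l) t)) = total (splice l p q) := by
    intro p q hpq
    funext t
    rcases le_or_gt t l with h | h
    · rw [cut_of_mem (mem_Iic.2 h)]
      simp [total, splice_of_le _ _ h]
    · rw [cut_of_notMem (by simpa using h), cut_of_mem (mem_Ici.2 h.le)]
      simp [total, splice_of_lt _ _ h]
  constructor
  · rintro ⟨_, ⟨p, hp, rfl⟩, _, ⟨q, hq, rfl⟩, l', h₁, -, h₃, rfl⟩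
    rw [dom_cut] at h₁
    obtain rfl : l = l' := isGreatest_Iic.unique h₁
    beta_reduce at h₃
    rw [cut_of_mem self_mem_Iic, cut_of_mem self_mem_Ici, Option.some_inj] at h₃
    exact ⟨p, hp, q, hq, h₃, key p q h₃⟩
  · rintro ⟨p, hp, q, hq, hpq, rfl⟩
    refine ⟨_, ⟨p, hp, rfl⟩, _, ⟨q, hq, rfl⟩, l, ?_, ?_, ?_, (key p q hpq).symm⟩
    · rw [dom_cut]; exact isGreatest_Iic
    · rw [dom_cut]; exact isLeast_Ici
    · beta_reduce
      rw [cut_of_mem self_mem_Iic, cut_of_mem self_mem_Ici, hpq]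

/-- If `α` is contained in `A` and `B`, and contains all `p[-∞,l] ∘ q[l,∞]` with `p ∈ A`, `q ∈ B`,
then `α = A[-∞,l] ∘ B[l,∞]`. -/
theorem total_image_eq_concat {α A B : Set (Λ → X)} {l : Λ} (hA : α ⊆ A) (hB : α ⊆ B)
    (h : ∀ p ∈ A, ∀ q ∈ B, p l = q l → splice l p q ∈ α) :
    total '' α = concat (cuts A (Iic l)) (cuts B (Ici l)) := by
  ext ρ
  rw [mem_concat_cuts_iff]
  constructor
  · rintro ⟨p, hp, rfl⟩
    exact ⟨p, hA hp, p, hB hp, rfl, by rw [splice_self]⟩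
  · rintro ⟨p, hp, q, hq, hpq, rfl⟩
    exact ⟨_, h p hp q hq hpq, rfl⟩

theorem splice_mem_of_isBoundedBelow {S α : Set (Λ → X)} {l : Λ} (h : IsBoundedBelow S α l)
    {p q : Λ → X} (hp : p ∈ S) (hq : q ∈ α) (hpq : p l = q l) : splice l p q ∈ α := by
  have : total (splice l p q) ∈ total '' α := by
    rw [h, mem_concat_cuts_iff]
    exact ⟨p, hp, q, hq, hpq, rfl⟩
  obtain ⟨r, hr, hrq⟩ := this
  rwa [← total_injective hrq]

theorem coarse_subset {S : Set (Λ → X)} {K : Set (Set (Λ → X))} (hK : IsCovering S K)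
    {α : Set (Λ → X)} (hα : α ∈ K) (l : Λ) : coarse K α l ⊆ cuts S (Iic l) := by
  have hsub : ∀ β ∈ K, cuts β (Iic l) ⊆ cuts S (Iic l) := fun β hβ =>
    image_mono (by rw [← hK]; exact subset_sUnion_of_mem hβ)
  intro σ hσ
  obtain ⟨n, hn⟩ := mem_iUnion.1 hσ
  cases n with
  | zero => exact hsub α hα hn
  | succ n =>
    obtain ⟨_, ⟨β, hβ, rfl⟩, -, h⟩ := hn
    exact hsub β hβ h

/-- Presents the coarse past as the past of a set of total paths, the form to which
`total_image_eq_concat` applies. -/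
theorem coarse_eq_cuts {S : Set (Λ → X)} {K : Set (Set (Λ → X))} (hK : IsCovering S K)
    {α : Set (Λ → X)} (hα : α ∈ K) (l : Λ) :
    coarse K α l = cuts {p ∈ S | cut p (Iic l) ∈ coarse K α l} (Iic l) := by
  ext σ
  constructor
  · intro h
    obtain ⟨p, hp, rfl⟩ := coarse_subset hK hα l h
    exact ⟨p, ⟨hp, h⟩, rfl⟩
  · rintro ⟨p, hp, rfl⟩
    exact hp.2

theorem cuts_subset_coarse (K : Set (Set (Λ → X))) (α : Set (Λ → X)) (l : Λ) :
    cuts α (Iic l) ⊆ coarse K α l := fun _ h => mem_iUnion.2 ⟨0, h⟩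

end Segments

/-! ### Infima and translations in the parameter -/

section Parameter

variable {Λ : Type*} [AddCommMonoid Λ] [LinearOrder Λ] [IsParameter Λ]

theorem exists_isGLB_of_nonempty {s : Set Λ} (hs : s.Nonempty) (hb : BddBelow s) :
    ∃ b, IsGLB s b := by
  obtain ⟨l, hl⟩ := IsParameter.exists_isLUB (lowerBounds s) hb
    (hs.mono fun _ hx _ hy => hy hx)
  exact ⟨l, isLUB_lowerBounds.1 hl⟩

/-- Replaces subtraction, which a monoid need not have. -/
theorem exists_nonneg_add_eq {a b : Λ} (h : a ≤ b) : ∃ m, 0 ≤ m ∧ b = m + a := by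
  obtain ⟨m, rfl⟩ := exists_add_of_le h
  exact ⟨m, by simpa using h, add_comm _ _⟩

theorem exists_add_eq_zero {l : Λ} (h : l ≤ 0) : ∃ δ, 0 ≤ δ ∧ l + δ = 0 := by
  obtain ⟨δ, hδ, h'⟩ := exists_nonneg_add_eq h
  exact ⟨δ, hδ, by rw [h', add_comm]⟩

/-- Infima of sets of non-negative times commute with translations. -/
theorem isGLB_shift_iff {P : Λ → Prop} {l b : Λ} (hb : 0 ≤ b) :
    IsGLB {t | l ≤ t ∧ P t} (b + l) ↔ IsGLB {t | 0 ≤ t ∧ P (t + l)} b := by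
  have aux : ∀ x, (x + l) ∈ lowerBounds {t | l ≤ t ∧ P t} ↔
      x ∈ lowerBounds {t | 0 ≤ t ∧ P (t + l)} := by
    intro x
    constructor
    · rintro h t ⟨ht, hP⟩
      exact le_of_add_le_add_right (h ⟨by simpa using ht, hP⟩)
    · rintro h t ⟨ht, hP⟩
      obtain ⟨m, hm, rfl⟩ := exists_nonneg_add_eq ht
      gcongr
      exact h ⟨hm, hP⟩
  constructor
  · rintro ⟨h₁, h₂⟩
    exact ⟨(aux b).1 h₁, fun x hx => le_of_add_le_add_right (h₂ ((aux x).2 hx))⟩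
  · rintro ⟨h₁, h₂⟩
    refine ⟨(aux b).2 h₁, fun x hx => ?_⟩
    -- A lower bound below `l` need not be a translate by `l`, but it is bounded by `l ≤ b + l`
    -- anyway.
    rcases le_total x l with h | h
    · exact h.trans (by simpa using hb)
    · obtain ⟨m, hm, rfl⟩ := exists_nonneg_add_eq h
      gcongr
      exact h₂ ((aux m).1 hx)

end Parameter

theorem Icc_inj_of_le {Λ : Type*} [LinearOrder Λ] {a b c d : Λ} (h : c ≤ d)
    (he : Icc a b = Icc c d) : a = c ∧ b = d := by
  have hab : a ≤ b := nonempty_Icc.1 (he ▸ nonempty_Icc.2 h)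
  exact ⟨(isLeast_Icc hab).unique (he ▸ isLeast_Icc h),
    (isGreatest_Icc hab).unique (he ▸ isGreatest_Icc h)⟩

/-! ### Components, hitting times and outcomes of shell paths -/

namespace ShellData

variable {Λ 𝒮 ℰ P : Type*} {Z : ShellData Λ 𝒮 ℰ P}

theorem partialInv_pair_eq_some_iff {z : P} {x : 𝒮 × ℰ} :
    Function.partialInv Z.pair z = some x ↔ Z.pair x = z :=
  Z.pair.injective.isPartialInv x z

theorem sysPart_eq_some_iff {σ : Seg Λ P} {t : Λ} {s : 𝒮} :
    Z.sysPart σ t = some s ↔ ∃ x, σ t = some (Z.pair (s, x)) := by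
  simp only [sysPart, Option.map_eq_some_iff, Option.bind_eq_some_iff,
    partialInv_pair_eq_some_iff]
  constructor
  · rintro ⟨⟨s', x⟩, ⟨z, hz, rfl⟩, rfl⟩
    exact ⟨x, hz⟩
  · rintro ⟨x, hx⟩
    exact ⟨(s, x), ⟨_, hx, rfl⟩, rfl⟩

theorem envPart_eq_some_iff {σ : Seg Λ P} {t : Λ} {x : ℰ} :
    Z.envPart σ t = some x ↔ ∃ s, σ t = some (Z.pair (s, x)) := by
  simp only [envPart, Option.map_eq_some_iff, Option.bind_eq_some_iff,
    partialInv_pair_eq_some_iff]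
  constructor
  · rintro ⟨⟨s, x'⟩, ⟨z, hz, rfl⟩, rfl⟩
    exact ⟨s, hz⟩
  · rintro ⟨s, hx⟩
    exact ⟨(s, x), ⟨_, hx, rfl⟩, rfl⟩

theorem cut_eq_some_iff {p : Λ → P} {A : Set Λ} {t : Λ} {z : P} :
    cut p A t = some z ↔ t ∈ A ∧ p t = z := by
  by_cases h : t ∈ A
  · simp [cut_of_mem h, h]
  · simp [cut_of_notMem h, h]

theorem isPartOf_cut_iff {p p' : Λ → P} {A B : Set Λ} :
    (cut p A).IsPartOf (cut p' B) ↔ ∀ t ∈ A, t ∈ B ∧ p' t = p t := by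
  simp only [Seg.IsPartOf, dom_cut]
  refine forall₂_congr fun t ht => ?_
  rw [cut_of_mem ht, cut_eq_some_iff]

theorem sysPart_cut_eq_cut_iff {p : Λ → P} {q : Λ → 𝒮} {A : Set Λ} :
    Z.sysPart (cut p A) = cut q A ↔ ∀ t ∈ A, ∃ x, p t = Z.pair (q t, x) := by
  constructor
  · intro h t ht
    have h' : Z.sysPart (cut p A) t = some (q t) := by rw [h, cut_of_mem ht]
    obtain ⟨x, hx⟩ := sysPart_eq_some_iff.1 h'
    exact ⟨x, (cut_eq_some_iff.1 hx).2⟩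
  · intro h
    funext t
    by_cases ht : t ∈ A
    · obtain ⟨x, hx⟩ := h t ht
      rw [cut_of_mem ht, sysPart_eq_some_iff]
      exact ⟨x, cut_eq_some_iff.2 ⟨ht, hx⟩⟩
    · rw [cut_of_notMem ht, Option.eq_none_iff_forall_ne_some]
      intro s hs
      obtain ⟨x, hx⟩ := sysPart_eq_some_iff.1 hs
      exact ht (cut_eq_some_iff.1 hx).1

theorem mem_states_of_mem {p : Λ → P} (hp : p ∈ Z.D) (t : Λ) : p t ∈ states Z.D :=
  ⟨p, hp, t, rfl⟩

section Order

variable [LinearOrder Λ]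

theorem mem_interior_of_path {p : Λ → P} {a t : Λ} (hp : p ∈ Z.D) (ha : p a ∈ Z.I) (hat : a ≤ t)
    (h : ∀ u, a ≤ u → u < t → p u ∉ Z.F) : p t ∈ Z.interior :=
  ⟨mem_states_of_mem hp t, _, p, hp, a, t, hat, ha, rfl, fun u hu => h u hu.1 hu.2, rfl⟩

/-- The path `p` starts at `a` in an initial state and `b` is the infimum of the subsequent times
at which it is in a final state. -/
structure Hits (Z : ShellData Λ 𝒮 ℰ P) (a : Λ) (p : Λ → P) (b : Λ) : Prop where
  mem : p ∈ Z.D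
  start : p a ∈ Z.I
  exists_final : ∃ t, a ≤ t ∧ p t ∈ Z.F
  isGLB : IsGLB {t | a ≤ t ∧ p t ∈ Z.F} b

/-- The path `p` goes from an initial state at `a` to a state in `A` at `c`, avoiding initial
states after `a`. -/
structure Reaches (Z : ShellData Λ 𝒮 ℰ P) (a : Λ) (p : Λ → P) (c : Λ) (A : Set P) : Prop where
  mem : p ∈ Z.D
  le : a ≤ c
  start : p a ∈ Z.I
  finish : p c ∈ A
  avoid : ∀ t ∈ Ioc a c, p t ∉ Z.I

theorem Hits.le {a b : Λ} {p : Λ → P} (h : Z.Hits a p b) : a ≤ b := h.isGLB.2 fun _ ht => ht.1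

theorem Hits.notMem_final {a b t : Λ} {p : Λ → P} (h : Z.Hits a p b) (ha : a ≤ t) (ht : t < b) :
    p t ∉ Z.F := fun hF => ht.not_ge (h.isGLB.1 ⟨ha, hF⟩)

/-- The time `b` is included, because the interior only requires that final states be avoided
strictly before `t`. -/
theorem Hits.mem_interior {a b t : Λ} {p : Λ → P} (h : Z.Hits a p b) (ha : a ≤ t) (ht : t ≤ b) :
    p t ∈ Z.interior :=
  mem_interior_of_path h.mem h.start ha fun _ hu hut => h.notMem_final hu (hut.trans_le ht)

/-- The infimum `b` need not be attained, so final states are only found arbitrarily soon after it.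
-/
theorem Hits.exists_mem_final {a b t : Λ} {p : Λ → P} (h : Z.Hits a p b) (ht : b < t) :
    ∃ u, b ≤ u ∧ u < t ∧ p u ∈ Z.F := by
  obtain ⟨u, ⟨hu, hF⟩, hut⟩ := (isGLB_lt_iff h.isGLB).1 ht
  exact ⟨u, h.isGLB.1 ⟨hu, hF⟩, hut, hF⟩

theorem mem_omega_iff {a : Λ} {A : Set P} {ρ : Seg Λ P} :
    ρ ∈ Z.omega a A ↔ ∃ p c, Z.Reaches a p c A ∧ ρ = cut p (Icc a c) := by
  constructor
  · rintro ⟨⟨p, hp, l₁, l₂, hl, h₁, h₂, h₃, rfl⟩, b, hab, hd⟩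
    rw [dom_cut] at hd
    obtain ⟨rfl, rfl⟩ := Icc_inj_of_le hab hd
    exact ⟨p, l₂, ⟨hp, hl, h₁, h₂, h₃⟩, rfl⟩
  · rintro ⟨p, c, h, rfl⟩
    exact ⟨⟨p, h.mem, a, c, h.le, h.start, h.finish, h.avoid, rfl⟩, c, h.le, dom_cut _ _⟩

/-- The path `p` that hits `F` and the path `p'` that reaches `A` may differ after `b`;
`isRun_of_reaches` later removes this distinction. -/
theorem mem_theta_iff {a : Λ} {A : Set P} {θ : Seg Λ P} :
    θ ∈ Z.theta a A ↔ ∃ p b p' c, Z.Hits a p b ∧ Z.Reaches a p' c A ∧ b ≤ c ∧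
      (∀ t ∈ Icc a b, p t = p' t) ∧ θ = cut p (Icc a b) := by
  constructor
  · rintro ⟨⟨p, hp, l₁, l₂, h₁, h₂, h₃, rfl⟩, ⟨b, hab, hd⟩, ρ, hρ, hpart⟩
    rw [dom_cut] at hd
    obtain ⟨rfl, rfl⟩ := Icc_inj_of_le hab hd
    obtain ⟨p', c, hp', rfl⟩ := mem_omega_iff.1 hρ
    have key := isPartOf_cut_iff.1 hpart
    exact ⟨p, l₂, p', c, ⟨hp, h₁, h₂, h₃⟩, hp', (key l₂ ⟨hab, le_rfl⟩).1.2,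
      fun t ht => (key t ht).2.symm, rfl⟩
  · rintro ⟨p, b, p', c, h, h', hbc, he, rfl⟩
    refine ⟨⟨p, h.mem, a, b, h.start, h.exists_final, h.isGLB, rfl⟩, ⟨b, h.le, dom_cut _ _⟩, _,
      mem_omega_iff.2 ⟨p', c, h', rfl⟩, isPartOf_cut_iff.2 fun t ht =>
        ⟨⟨ht.1, ht.2.trans hbc⟩, (he t ht).symm⟩⟩

theorem outcome_mono {a : Λ} {E E' : Set ℰ} (h : E ⊆ E') : Z.outcome a E ⊆ Z.outcome a E' := by
  rintro _ ⟨θ, hθ, rfl⟩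
  obtain ⟨p, b, p', c, h₁, h₂, h₃⟩ := mem_theta_iff.1 hθ
  exact ⟨θ, mem_theta_iff.2 ⟨p, b, p', c, h₁, ⟨h₂.mem, h₂.le, h₂.start,
    image_mono (prod_mono_right h) h₂.finish, h₂.avoid⟩, h₃⟩, rfl⟩

end Order

variable [AddCommMonoid Λ] [LinearOrder Λ]

namespace IsEnvironmentalShell

/-- For pairs with a system state as first component, finality depends on the environment alone. -/
theorem mem_final_of_mem_domain (hZ : Z.IsEnvironmentalShell) {s : 𝒮} {x : ℰ}
    (hs : s ∈ Z.sys) (hx : x ∈ Z.envFin) (h : Z.pair (s, x) ∈ states Z.D) :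
    Z.pair (s, x) ∈ Z.F := by
  rw [← hZ.final_eq]
  exact ⟨⟨(s, x), ⟨hs, hx⟩, rfl⟩, h⟩

theorem exists_of_mem_final (hZ : Z.IsEnvironmentalShell) {z : P} (hz : z ∈ Z.F) :
    ∃ s ∈ Z.sys, ∃ x ∈ Z.envFin, Z.pair (s, x) = z := by
  rw [← hZ.final_eq] at hz
  obtain ⟨⟨⟨s, x⟩, ⟨hs, hx⟩, rfl⟩, -⟩ := hz
  exact ⟨s, hs, x, hx, rfl⟩

theorem exists_of_mem_interior (hZ : Z.IsEnvironmentalShell) {z : P} (hz : z ∈ Z.interior) :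
    ∃ s ∈ Z.sys, ∃ x, Z.pair (s, x) = z := by
  rw [← hZ.interior_eq] at hz
  obtain ⟨⟨⟨s, x⟩, ⟨hs, hx⟩, rfl⟩, -⟩ := hz
  exact ⟨s, hs, x, rfl⟩

theorem exists_of_mem_domain (hZ : Z.IsEnvironmentalShell) {z : P} (hz : z ∈ Z.domain) :
    ∃ s ∈ Z.sys, ∃ x, Z.pair (s, x) = z := by
  rcases hz with hz | hz
  · obtain ⟨s, hs, x, -, h⟩ := hZ.exists_of_mem_final hz
    exact ⟨s, hs, x, h⟩
  · exact hZ.exists_of_mem_interior hz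

theorem mem_final_of_mem_withEnv (hZ : Z.IsEnvironmentalShell) {E : Set ℰ} (hE : E ⊆ Z.envFin)
    {z : P} (hz : z ∈ Z.withEnv E) (h : z ∈ states Z.D) : z ∈ Z.F := by
  obtain ⟨⟨s, x⟩, ⟨hs, hx⟩, rfl⟩ := hz
  exact hZ.mem_final_of_mem_domain hs (hE hx) h

end IsEnvironmentalShell

theorem dom_sysPart_cut (hZ : Z.IsEnvironmentalShell) {p : Λ → P} {A : Set Λ}
    (h : ∀ t ∈ A, p t ∈ Z.interior) : (Z.sysPart (cut p A)).dom = A := by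
  ext t
  constructor
  · rintro ⟨s, hs⟩
    obtain ⟨x, hx⟩ := sysPart_eq_some_iff.1 hs
    exact (cut_eq_some_iff.1 hx).1
  · intro ht
    obtain ⟨s, -, x, hx⟩ := hZ.exists_of_mem_interior (h t ht)
    exact ⟨s, sysPart_eq_some_iff.2 ⟨x, cut_eq_some_iff.2 ⟨ht, hx.symm⟩⟩⟩

theorem Hits.dom_sysPart (hZ : Z.IsEnvironmentalShell) {a b : Λ} {p : Λ → P}
    (h : Z.Hits a p b) : (Z.sysPart (cut p (Icc a b))).dom = Icc a b :=
  dom_sysPart_cut hZ fun _ ht => h.mem_interior ht.1 ht.2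

/-- States up to the hitting time are interior, hence pairs, so the domain of the system component
shows the duration. -/
theorem Hits.eq_of_sysPart_eq (hZ : Z.IsEnvironmentalShell) {a b b' : Λ} {p : Λ → P}
    {q : Λ → 𝒮} (h : Z.Hits a p b) (he : Z.sysPart (cut p (Icc a b)) = cut q (Icc a b')) :
    b = b' := by
  have hd : Icc a b = Icc a b' := by rw [← h.dom_sysPart hZ, he, dom_cut]
  exact (Icc_inj_of_le h.le hd.symm).2.symm

/-- The system component of a path, up to the time at which it hits the final states. -/
theorem Hits.exists_sys (hZ : Z.IsEnvironmentalShell) {a b : Λ} {p : Λ → P}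
    (h : Z.Hits a p b) : ∃ q : Λ → 𝒮, ∀ t ∈ Icc a b, ∃ x, p t = Z.pair (q t, x) := by
  have key : ∀ t, ∃ s, t ∈ Icc a b → ∃ x, p t = Z.pair (s, x) := by
    intro t
    by_cases ht : t ∈ Icc a b
    · obtain ⟨s, -, x, hx⟩ := hZ.exists_of_mem_interior (h.mem_interior ht.1 ht.2)
      exact ⟨s, fun _ => ⟨x, hx.symm⟩⟩
    · obtain ⟨s, -⟩ := hZ.exists_of_mem_interior (h.mem_interior le_rfl h.le)
      exact ⟨s, fun h => absurd h ht⟩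
  choose q hq using key
  exact ⟨q, hq⟩

theorem cut_mem_outcome_iff {a b : Λ} (hab : a ≤ b) {E : Set ℰ} {q : Λ → 𝒮}
    (hZ : Z.IsEnvironmentalShell) :
    cut q (Icc a b) ∈ Z.outcome a E ↔ ∃ p p' c, Z.Hits a p b ∧ Z.Reaches a p' c (Z.withEnv E) ∧
      b ≤ c ∧ (∀ t ∈ Icc a b, p t = p' t) ∧ ∀ t ∈ Icc a b, ∃ x, p t = Z.pair (q t, x) := by
  constructor
  · rintro ⟨θ, hθ, he⟩
    obtain ⟨p, b', p', c, h, h', hbc, hpp, rfl⟩ := mem_theta_iff.1 hθ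
    obtain rfl := h.eq_of_sysPart_eq hZ he
    exact ⟨p, p', c, h, h', hbc, hpp, sysPart_cut_eq_cut_iff.1 he⟩
  · rintro ⟨p, p', c, h, h', hbc, hpp, hq⟩
    exact ⟨_, mem_theta_iff.2 ⟨p, b, p', c, h, h', hbc, hpp, rfl⟩, sysPart_cut_eq_cut_iff.2 hq⟩

theorem dom_of_mem_outcome (hZ : Z.IsEnvironmentalShell) {a : Λ} {E : Set ℰ} {σ : Seg Λ 𝒮}
    (hσ : σ ∈ Z.outcome a E) : ∃ b, a ≤ b ∧ σ.dom = Icc a b := by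
  obtain ⟨θ, hθ, rfl⟩ := hσ
  obtain ⟨p, b, p', c, h, -, -, -, rfl⟩ := mem_theta_iff.1 hθ
  exact ⟨b, h.le, h.dom_sysPart hZ⟩

theorem mem_through_outcome_iff (hZ : Z.IsEnvironmentalShell) {S : Set (Λ → 𝒮)} {a : Λ}
    {E : Set ℰ} {q : Λ → 𝒮} :
    q ∈ through S (Z.outcome a E) ↔ q ∈ S ∧ ∃ b, a ≤ b ∧ cut q (Icc a b) ∈ Z.outcome a E := by
  constructor
  · rintro ⟨hq, σ, hσ, hpart⟩
    obtain ⟨b, hab, hd⟩ := dom_of_mem_outcome hZ hσ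
    rw [isPartOf_total_iff hd] at hpart
    exact ⟨hq, b, hab, hpart ▸ hσ⟩
  · rintro ⟨hq, b, -, h⟩
    exact mem_through_of_cut_mem hq h

/-! ### Invariance of outcomes under translations -/

section Translation

variable [IsParameter Λ]

theorem IsShell.shift_mem (hZ : Z.IsShell) {p : Λ → P} (hp : p ∈ Z.D) {l : Λ} (hl : p l ∈ Z.I) :
    (fun t => p (t + l)) ∈ Z.D := by
  -- Homogeneity only covers shifts by `δ ≥ 0`; for `l ≤ 0` it is applied with the `δ` inverse to
  -- `l`, in the opposite direction.
  rcases le_total 0 l with h | h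
  · have := (hZ.homogeneous 0 l (p l) h (hZ.realized _ hl 0) (hZ.realized _ hl _)
      (fun t => p (t + l))).2 ⟨p, hp, by simp, fun t => rfl⟩
    exact this.1
  · obtain ⟨δ, hδ, hlδ⟩ := exists_add_eq_zero h
    obtain ⟨p', hp', -, he⟩ := (hZ.homogeneous l δ (p l) hδ (hZ.realized _ hl _)
      (hZ.realized _ hl _) p).1 ⟨hp, rfl⟩
    convert hp' using 1
    funext t
    rw [he, add_assoc, hlδ, add_zero]

theorem IsShell.exists_shift_eq (hZ : Z.IsShell) {p : Λ → P} (hp : p ∈ Z.D) (h0 : p 0 ∈ Z.I)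
    (l : Λ) : ∃ p' ∈ Z.D, p = fun t => p' (t + l) := by
  rcases le_total 0 l with h | h
  · obtain ⟨p', hp', -, he⟩ := (hZ.homogeneous 0 l (p 0) h (hZ.realized _ h0 0)
      (hZ.realized _ h0 _) p).1 ⟨hp, rfl⟩
    exact ⟨p', hp', funext he⟩
  · obtain ⟨δ, hδ, hlδ⟩ := exists_add_eq_zero h
    have := (hZ.homogeneous l δ (p 0) hδ (hZ.realized _ h0 _) (hZ.realized _ h0 _)
      (fun t => p (t + δ))).2 ⟨p, hp, by rw [hlδ], fun t => rfl⟩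
    refine ⟨_, this.1, ?_⟩
    funext t
    rw [add_assoc, hlδ, add_zero]

theorem hits_shift_iff (hZ : Z.IsShell) {p : Λ → P} (hp : p ∈ Z.D) {l b : Λ} (hb : 0 ≤ b) :
    Z.Hits 0 (fun t => p (t + l)) b ↔ Z.Hits l p (b + l) := by
  constructor
  · rintro ⟨-, h₂, ⟨t, ht, hF⟩, h₄⟩
    exact ⟨hp, by simpa using h₂, ⟨t + l, by simpa using ht, hF⟩,
      (isGLB_shift_iff (P := fun t => p t ∈ Z.F) hb).2 h₄⟩
  · rintro ⟨-, h₂, ⟨t, ht, hF⟩, h₄⟩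
    obtain ⟨m, hm, rfl⟩ := exists_nonneg_add_eq ht
    exact ⟨hZ.shift_mem hp h₂, by simpa using h₂, ⟨m, hm, hF⟩,
      (isGLB_shift_iff (P := fun t => p t ∈ Z.F) hb).1 h₄⟩

theorem reaches_shift_iff (hZ : Z.IsShell) {p : Λ → P} (hp : p ∈ Z.D) {l c : Λ} {A : Set P} :
    Z.Reaches 0 (fun t => p (t + l)) c A ↔ Z.Reaches l p (c + l) A := by
  constructor
  · rintro ⟨-, h₂, h₃, h₄, h₅⟩
    refine ⟨hp, by simpa using h₂, by simpa using h₃, h₄, fun t ht => ?_⟩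
    obtain ⟨m, hm, rfl⟩ := exists_nonneg_add_eq ht.1.le
    exact h₅ m ⟨by simpa using ht.1, by simpa using ht.2⟩
  · rintro ⟨-, h₂, h₃, h₄, h₅⟩
    exact ⟨hZ.shift_mem hp h₃, by simpa using h₂, by simpa using h₃, h₄,
      fun t ht => h₅ (t + l) ⟨by simpa using ht.1, by simpa using ht.2⟩⟩

theorem forall_Icc_shift_iff {l b : Λ} {Q : Λ → Prop} :
    (∀ t ∈ Icc l (b + l), Q t) ↔ ∀ t ∈ Icc 0 b, Q (t + l) := by
  constructor
  · exact fun h t ht => h _ ⟨by simpa using ht.1, by simpa using ht.2⟩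
  · intro h t ht
    obtain ⟨m, hm, rfl⟩ := exists_nonneg_add_eq ht.1
    exact h m ⟨hm, by simpa using ht.2⟩

/-- Outcomes are invariant under translations. -/
theorem cut_shift_mem_outcome_iff (hZ : Z.IsEnvironmentalShell) {E : Set ℰ} {q : Λ → 𝒮}
    {l b : Λ} (hb : 0 ≤ b) :
    cut (fun t => q (t + l)) (Icc 0 b) ∈ Z.outcome 0 E ↔
      cut q (Icc l (b + l)) ∈ Z.outcome l E := by
  have hlb : l ≤ b + l := by simpa using hb
  rw [cut_mem_outcome_iff hb hZ, cut_mem_outcome_iff hlb hZ]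
  constructor
  · rintro ⟨p, p', c, h, h', hbc, hpp, hq⟩
    obtain ⟨p, hp, rfl⟩ := hZ.shell.exists_shift_eq h.mem h.start l
    obtain ⟨p', hp', rfl⟩ := hZ.shell.exists_shift_eq h'.mem h'.start l
    exact ⟨p, p', c + l, (hits_shift_iff hZ.shell hp hb).1 h,
      (reaches_shift_iff hZ.shell hp').1 h', by gcongr, forall_Icc_shift_iff.2 hpp,
      forall_Icc_shift_iff.2 hq⟩
  · rintro ⟨p, p', c, h, h', hbc, hpp, hq⟩
    obtain ⟨c, hc, rfl⟩ := exists_nonneg_add_eq h'.le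
    exact ⟨_, _, c, (hits_shift_iff hZ.shell h.mem hb).2 h,
      (reaches_shift_iff hZ.shell h'.mem).2 h', by simpa using hbc,
      forall_Icc_shift_iff.1 hpp, forall_Icc_shift_iff.1 hq⟩

theorem mem_through_outcome_shift_iff (hZ : Z.IsEnvironmentalShell) {S : Set (Λ → 𝒮)} {l : Λ}
    {E : Set ℰ} {q : Λ → 𝒮} :
    q ∈ through S (Z.outcome l E) ↔
      q ∈ S ∧ ∃ b, 0 ≤ b ∧ cut (fun t => q (t + l)) (Icc 0 b) ∈ Z.outcome 0 E := by
  rw [mem_through_outcome_iff hZ]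
  refine and_congr_right fun _ => ⟨?_, ?_⟩
  · rintro ⟨b, hb, h⟩
    obtain ⟨b, hb', rfl⟩ := exists_nonneg_add_eq hb
    exact ⟨b, hb', (cut_shift_mem_outcome_iff hZ hb').2 h⟩
  · rintro ⟨b, hb, h⟩
    exact ⟨b + l, by simpa using hb, (cut_shift_mem_outcome_iff hZ hb).1 h⟩

end Translation

end ShellData

/-! ### Runs and the automata condition -/

namespace ShellData

variable {Λ 𝒮 ℰ P : Type*} {Z : ShellData Λ 𝒮 ℰ P} [AddCommMonoid Λ] [LinearOrder Λ]

/-- The path `p` runs from an initial state at `0` to a final state with second component `e` at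
`c`, and `b` is the infimum of the times at which it is in a final state. -/
structure IsRun (Z : ShellData Λ 𝒮 ℰ P) (p : Λ → P) (b c : Λ) (e : ℰ) : Prop where
  hits : Z.Hits 0 p b
  reaches : Z.Reaches 0 p c (Z.withEnv {e})
  le : b ≤ c

namespace IsRun

variable {p p' : Λ → P} {b b' c c' : Λ} {e e' : ℰ}

theorem nonneg (h : Z.IsRun p b c e) : 0 ≤ b := h.hits.le

theorem finish_eq (h : Z.IsRun p b c e) : ∃ s ∈ Z.sys, p c = Z.pair (s, e) := by
  obtain ⟨⟨s, x⟩, ⟨hs, rfl⟩, hx⟩ := h.reaches.finish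
  exact ⟨s, hs, hx.symm⟩

/-- If two paths have the same environmental component at `t`, the first one is in a final state
and the second one is in the shell interior, then the second one is in a final state, too. -/
theorem mem_final_of_envPart_eq (hZ : Z.IsEnvironmentalShell) {t : Λ} (ht : 0 ≤ t)
    (htc : t ≤ c') (hp' : p' ∈ Z.D)
    (henv : Z.envPart (cut p' (Icc 0 c')) t = Z.envPart (cut p (Icc 0 c)) t)
    (hF : p t ∈ Z.F) (hint : p' t ∈ Z.interior) : p' t ∈ Z.F := by
  obtain ⟨s', hs', x, hx⟩ := hZ.exists_of_mem_interior hint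
  have h : Z.envPart (cut p' (Icc 0 c')) t = some x :=
    envPart_eq_some_iff.2 ⟨s', cut_eq_some_iff.2 ⟨⟨ht, htc⟩, hx.symm⟩⟩
  rw [henv] at h
  obtain ⟨s, hs⟩ := envPart_eq_some_iff.1 h
  obtain ⟨-, hs⟩ := cut_eq_some_iff.1 hs
  rw [hs] at hF
  rw [← hx]
  exact hZ.mem_final_of_mem_domain hs' ⟨s, hF⟩ (hx ▸ mem_states_of_mem hp' t)

/-- If the environmental components of two runs agree before `m`, and the second run does not hit
the final states before `m`, then neither does the first one. -/
theorem le_of_envPart_eq (hZ : Z.IsEnvironmentalShell) {m : Λ} (h : Z.IsRun p b c e)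
    (h' : Z.IsRun p' b' c' e') (hm : m ≤ b')
    (henv : ∀ t < m, Z.envPart (cut p' (Icc 0 c')) t = Z.envPart (cut p (Icc 0 c)) t) :
    m ≤ b := by
  by_contra! hlt
  obtain ⟨t, hbt, htm, hF⟩ := h.hits.exists_mem_final hlt
  have ht : 0 ≤ t := h.nonneg.trans hbt
  have htb : t < b' := htm.trans_le hm
  exact h'.hits.notMem_final ht htb (mem_final_of_envPart_eq hZ ht (htb.le.trans h'.le)
    h'.hits.mem (henv t htm) hF (h'.hits.mem_interior ht htb.le))

/-- Joining the start of a run to the end of another one before the final states are hit. -/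
theorem splice (hZ : Z.IsShell) {m : Λ} (hm : 0 ≤ m) (h : Z.IsRun p b c e)
    (h' : Z.IsRun p' b' c' e') (hpp : p m = p' m) (hmb : m < b) (hmb' : m ≤ b') :
    Z.IsRun (splice m p p') b' c' e' := by
  have hmem := hZ.dynamicSpace.2 p h.hits.mem p' h'.hits.mem m hpp
  have h0 : DynExp.splice m p p' 0 ∈ Z.I := by
    rw [splice_of_le _ _ hm]; exact h.hits.start
  -- Before `m` neither path is in a final state, and from `m` on the splice is `p'`, so the final
  -- times are those of `p'`.
  have hF : {t | 0 ≤ t ∧ DynExp.splice m p p' t ∈ Z.F} = {t | 0 ≤ t ∧ p' t ∈ Z.F} := by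
    ext t
    refine and_congr_right fun ht => ?_
    rcases lt_or_ge t m with htm | htm
    · rw [splice_of_le _ _ htm.le]
      exact iff_of_false (h.hits.notMem_final ht (htm.trans hmb))
        (h'.hits.notMem_final ht (htm.trans_le hmb'))
    · rw [splice_of_ge hpp htm]
  have hmc : m ≤ c' := hmb'.trans h'.le
  refine ⟨⟨hmem, h0, ?_, ?_⟩, ⟨hmem, h'.reaches.le, h0, ?_, ?_⟩, h'.le⟩
  · change Set.Nonempty {t | 0 ≤ t ∧ DynExp.splice m p p' t ∈ Z.F}
    rw [hF]
    exact h'.hits.exists_final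
  · rw [hF]; exact h'.hits.isGLB
  · rw [splice_of_ge hpp hmc]; exact h'.reaches.finish
  · intro t ht
    rcases le_or_gt t m with htm | htm
    · rw [splice_of_le _ _ htm]
      exact h.reaches.avoid t ⟨ht.1, htm.trans (hmb.le.trans h.le)⟩
    · rw [splice_of_lt _ _ htm]
      exact h'.reaches.avoid t ht

end IsRun

theorem AutomataCondition.eq_of_eqOn (hA : Z.AutomataCondition) {q q' : Λ → 𝒮} {b b' : Λ}
    (h : cut q (Icc 0 b) ∈ Z.outcome 0 Z.envFin) (h' : cut q' (Icc 0 b') ∈ Z.outcome 0 Z.envFin)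
    (he : ∀ t, 0 ≤ t → t ≤ b → t ≤ b' → q t = q' t) : b = b' := by
  have aux : ∀ {q q' : Λ → 𝒮} {b b' : Λ}, cut q (Icc 0 b) ∈ Z.outcome 0 Z.envFin →
      cut q' (Icc 0 b') ∈ Z.outcome 0 Z.envFin →
      (∀ t, 0 ≤ t → t ≤ b → t ≤ b' → q t = q' t) → ¬ b < b' := by
    intro q q' b b' h h' he hlt
    refine hA _ h _ h' b b' (dom_cut _ _) (dom_cut _ _) hlt ?_
    rw [restrict_cut, inter_eq_self_of_subset_right (Icc_subset_Icc_right hlt.le),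
      cut_eq_cut_iff]
    exact fun t ht => he t ht.1 ht.2 (ht.2.trans hlt.le)
  exact le_antisymm (not_lt.1 (aux h' h fun t h₁ h₂ h₃ => (he t h₁ h₃ h₂).symm))
    (not_lt.1 (aux h h' he))

section Automata

variable [IsParameter Λ]

theorem Reaches.exists_hits {a c : Λ} {p : Λ → P} (h : Z.Reaches a p c Z.F) :
    ∃ b ≤ c, Z.Hits a p b := by
  have hne : {t | a ≤ t ∧ p t ∈ Z.F}.Nonempty := ⟨c, h.le, h.finish⟩
  obtain ⟨b, hb⟩ := exists_isGLB_of_nonempty hne ⟨a, fun t ht => ht.1⟩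
  exact ⟨b, hb.1 ⟨h.le, h.finish⟩, h.mem, h.start, hne, hb⟩

/-- By the automata condition, a path that agrees with a run until the final states are hit, and
reaches a final state, hits the final states at the same time. -/
theorem isRun_of_reaches (hE : Z.IsEnvironmentalShell) (hA : Z.AutomataCondition) {p p' : Λ → P}
    {b c : Λ} {e : ℰ} (he : e ∈ Z.envFin) (h : Z.Hits 0 p b)
    (h' : Z.Reaches 0 p' c (Z.withEnv {e})) (hbc : b ≤ c) (hpp : ∀ t ∈ Icc 0 b, p t = p' t) :
    Z.IsRun p' b c e := by
  have hF : Z.Reaches 0 p' c Z.F := ⟨h'.mem, h'.le, h'.start, hE.mem_final_of_mem_withEnv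
    (singleton_subset_iff.2 he) h'.finish (mem_states_of_mem h'.mem c), h'.avoid⟩
  have hfin : Z.Reaches 0 p' c (Z.withEnv Z.envFin) := ⟨h'.mem, h'.le, h'.start,
    image_mono (prod_mono_right (singleton_subset_iff.2 he)) h'.finish, h'.avoid⟩
  obtain ⟨b', hb'c, hb'⟩ := hF.exists_hits
  -- An earlier final state of `p'` would also be one of `p`, since the two agree up to `b`.
  have hle : b ≤ b' := by
    by_contra! hlt
    obtain ⟨t, hbt, htb, htF⟩ := hb'.exists_mem_final hlt
    have ht : 0 ≤ t := hb'.le.trans hbt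
    exact h.notMem_final ht htb (hpp t ⟨ht, htb.le⟩ ▸ htF)
  -- Both `q[0,b]`, via `p`, and `q[0,b']`, via `p'`, are outcomes, so the automata condition yields
  -- `b = b'`.
  obtain ⟨q, hq⟩ := hb'.exists_sys hE
  have h₁ : cut q (Icc 0 b) ∈ Z.outcome 0 Z.envFin :=
    (cut_mem_outcome_iff h.le hE).2 ⟨p, p', c, h, hfin, hbc, hpp, fun t ht => by
      rw [hpp t ht]; exact hq t ⟨ht.1, ht.2.trans hle⟩⟩
  have h₂ : cut q (Icc 0 b') ∈ Z.outcome 0 Z.envFin :=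
    (cut_mem_outcome_iff hb'.le hE).2 ⟨p', p', c, hb', hfin, hb'c, fun _ _ => rfl, hq⟩
  obtain rfl := hA.eq_of_eqOn h₁ h₂ fun _ _ _ _ => rfl
  exact ⟨hb', h', hbc⟩

/-- Outcomes are the system components of runs. -/
theorem cut_mem_outcome_iff_exists_isRun (hE : Z.IsEnvironmentalShell)
    (hA : Z.AutomataCondition) {e : ℰ} (he : e ∈ Z.envFin) {q : Λ → 𝒮} {b : Λ} (hb : 0 ≤ b) :
    cut q (Icc 0 b) ∈ Z.outcome 0 {e} ↔
      ∃ p c, Z.IsRun p b c e ∧ ∀ t ∈ Icc 0 b, ∃ x, p t = Z.pair (q t, x) := by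
  rw [cut_mem_outcome_iff hb hE]
  constructor
  · rintro ⟨p, p', c, h, h', hbc, hpp, hq⟩
    refine ⟨p', c, isRun_of_reaches hE hA he h h' hbc hpp, fun t ht => ?_⟩
    rw [← hpp t ht]
    exact hq t ht
  · rintro ⟨p, c, h, hq⟩
    exact ⟨p, p, c, h.hits, h.reaches, h.le, fun _ _ => rfl, hq⟩

end Automata

end ShellData

/-! ### Outcomes and environments in ideal e-automata -/

namespace ShellData

variable {Λ 𝒮 ℰ P : Type*} {Z : ShellData Λ 𝒮 ℰ P} [AddCommMonoid Λ] [LinearOrder Λ]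

theorem IsRun.mem_theta (hE : Z.IsEnvironmentalShell) {p : Λ → P} {b c : Λ} {e : ℰ}
    (he : e ∈ Z.envFin) (h : Z.IsRun p b c e) : cut p (Icc 0 b) ∈ Z.theta 0 Z.F :=
  mem_theta_iff.2 ⟨p, b, p, c, h.hits, ⟨h.reaches.mem, h.reaches.le, h.reaches.start,
    hE.mem_final_of_mem_withEnv (singleton_subset_iff.2 he) h.reaches.finish
      (mem_states_of_mem h.reaches.mem c), h.reaches.avoid⟩, h.le, fun _ _ => rfl, rfl⟩

theorem exists_isRun_of_mem_theta [IsParameter Λ] (hE : Z.IsEnvironmentalShell) (hA : Z.AutomataCondition)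
    {θ : Seg Λ P} (hθ : θ ∈ Z.theta 0 Z.F) :
    ∃ p b c, ∃ e ∈ Z.envFin, Z.IsRun p b c e ∧ θ = cut p (Icc 0 b) := by
  obtain ⟨p, b, p', c, h, h', hbc, hpp, rfl⟩ := mem_theta_iff.1 hθ
  obtain ⟨s, hs, e, he, hse⟩ := hE.exists_of_mem_final h'.finish
  exact ⟨p', b, c, e, he, isRun_of_reaches hE hA he h
    ⟨h'.mem, h'.le, h'.start, ⟨(s, e), ⟨hs, rfl⟩, hse⟩, h'.avoid⟩ hbc hpp,
    cut_eq_cut_iff.2 hpp⟩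

/-- The environmental component of the run `p'` up to `c'` can, up to `m`, accompany a run that
leads to the same outcomes as `e`. -/
def Accompanies (Z : ShellData Λ 𝒮 ℰ P) (e : ℰ) (m : Λ) (p' : Λ → P) (c' : Λ) : Prop :=
  ∃ e₁ ∈ Z.envFin, Z.outcome 0 {e₁} = Z.outcome 0 {e} ∧ ∃ p b c, Z.IsRun p b c e₁ ∧
    ∀ t ≤ m, Z.envPart (cut p (Icc 0 c)) t = Z.envPart (cut p' (Icc 0 c')) t

/-- Agreement of environments up to `m` is transitive; this is what carries accompaniment along a
chain. -/
theorem Accompanies.trans {e e' : ℰ} {m c' : Λ} {p' : Λ → P} (h : Z.Accompanies e' m p' c')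
    (h' : ∀ e₁ ∈ Z.envFin, Z.outcome 0 {e₁} = Z.outcome 0 {e'} → ∀ p b c, Z.IsRun p b c e₁ →
      Z.Accompanies e m p c) : Z.Accompanies e m p' c' := by
  obtain ⟨e₁, he₁, ho₁, p, b, c, hp, henv⟩ := h
  obtain ⟨e₂, he₂, ho₂, p₂, b₂, c₂, hp₂, henv₂⟩ := h' e₁ he₁ ho₁ p b c hp
  exact ⟨e₂, he₂, ho₂, p₂, b₂, c₂, hp₂, fun t ht => (henv₂ t ht).trans (henv t ht)⟩

namespace IsIdealEAutomaton

theorem shell (hZ : Z.IsIdealEAutomaton) : Z.IsEnvironmentalShell :=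
  hZ.eAutomaton.environmentalShell

/-- Outcomes that agree as long as both last have the same duration and determine the same set of
outcomes. -/
theorem eq_of_eqOn (hZ : Z.IsIdealEAutomaton) {e e' : ℰ} (he : e ∈ Z.envFin)
    (he' : e' ∈ Z.envFin) {q q' : Λ → 𝒮} {b b' : Λ} (h : cut q (Icc 0 b) ∈ Z.outcome 0 {e})
    (h' : cut q' (Icc 0 b') ∈ Z.outcome 0 {e'})
    (hq : ∀ t, 0 ≤ t → t ≤ b → t ≤ b' → q t = q' t) :
    b = b' ∧ Z.outcome 0 {e} = Z.outcome 0 {e'} := by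
  obtain rfl := hZ.eAutomaton.automataCondition.eq_of_eqOn
    (outcome_mono (singleton_subset_iff.2 he) h) (outcome_mono (singleton_subset_iff.2 he') h') hq
  refine ⟨rfl, (hZ.boolean e he e' he').resolve_right fun hd => ?_⟩
  rw [cut_eq_cut_iff.2 fun t ht => hq t ht.1 ht.2 ht.2] at h
  exact disjoint_left.1 hd h h'

/-- Both states are reached with the same system history `q[0,m]`, which is the start of an outcome
of `e` and so lies in the coarse outcome already at stage `0`. -/
theorem undifferentiated (hZ : Z.IsIdealEAutomaton) {e : ℰ} (he : e ∈ Z.envFin)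
    {q : Λ → 𝒮} {m b : Λ} (hm : 0 ≤ m) (hmb : m ≤ b) (h : cut q (Icc 0 b) ∈ Z.outcome 0 {e})
    {p₁ p₂ : Λ → P} {b₁ b₂ c₁ c₂ : Λ} {e₁ e₂ : ℰ} (he₁ : e₁ ∈ Z.envFin) (he₂ : e₂ ∈ Z.envFin)
    (h₁ : Z.IsRun p₁ b₁ c₁ e₁) (h₂ : Z.IsRun p₂ b₂ c₂ e₂) (hm₁ : m ≤ b₁) (hm₂ : m ≤ b₂)
    (hq₁ : ∀ t ∈ Icc 0 m, ∃ x, p₁ t = Z.pair (q t, x))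
    (hq₂ : ∀ t ∈ Icc 0 m, ∃ x, p₂ t = Z.pair (q t, x)) : Z.Undifferentiated (p₁ m) (p₂ m) := by
  have hcoarse : cut q (Icc 0 m) ∈ Z.coarseOutcome e m := by
    refine mem_iUnion.2 ⟨0, cut q (Icc 0 b), h, ?_, ?_⟩
    · rw [dom_cut]; exact Icc_subset_Icc_right hmb
    · rw [restrict_cut, inter_eq_self_of_subset_right (Icc_subset_Icc_right hmb)]
  have hsigma : ∀ {p : Λ → P} {b c : Λ} {e : ℰ}, e ∈ Z.envFin → Z.IsRun p b c e → m ≤ b →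
      (∀ t ∈ Icc 0 m, ∃ x, p t = Z.pair (q t, x)) → cut q (Icc 0 m) ∈ Z.sigma {p m} := by
    intro p b c e he hp hmb hq
    refine ⟨_, hp.mem_theta hZ.shell he, m, _, rfl, cut_of_mem ⟨hm, hmb⟩, ?_⟩
    rw [restrict_cut, inter_eq_self_of_subset_right (Icc_subset_Icc_right hmb)]
    exact (sysPart_cut_eq_cut_iff.2 hq).symm
  exact ⟨h₁.hits.mem_interior hm hm₁, h₂.hits.mem_interior hm hm₂, e, he, m, hm,
    ⟨_, hsigma he₁ h₁ hm₁ hq₁, hcoarse⟩, ⟨_, hsigma he₂ h₂ hm₂ hq₂, hcoarse⟩⟩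

variable [IsParameter Λ]

theorem exists_isRun (hZ : Z.IsIdealEAutomaton) {e : ℰ} (he : e ∈ Z.envFin) {q : Λ → 𝒮} {b : Λ}
    (hb : 0 ≤ b) (h : cut q (Icc 0 b) ∈ Z.outcome 0 {e}) :
    ∃ p c, Z.IsRun p b c e ∧ ∀ t ∈ Icc 0 b, ∃ x, p t = Z.pair (q t, x) :=
  (cut_mem_outcome_iff_exists_isRun hZ.shell hZ.eAutomaton.automataCondition he hb).1 h

theorem cut_mem_outcome (hZ : Z.IsIdealEAutomaton) {e : ℰ} (he : e ∈ Z.envFin) {q : Λ → 𝒮}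
    {p : Λ → P} {b c : Λ} (h : Z.IsRun p b c e) (hq : ∀ t ∈ Icc 0 b, ∃ x, p t = Z.pair (q t, x)) :
    cut q (Icc 0 b) ∈ Z.outcome 0 {e} :=
  (cut_mem_outcome_iff_exists_isRun hZ.shell hZ.eAutomaton.automataCondition he h.nonneg).2
    ⟨p, c, h, hq⟩

/-- As the shell is all-reet, all outcomes of `e` are accompanied by the environmental component
of any run that leads to `e`. -/
theorem exists_isRun_envPart_eq (hZ : Z.IsIdealEAutomaton) {e : ℰ} (he : e ∈ Z.envFin)
    {p' : Λ → P} {b' c' : Λ} (h' : Z.IsRun p' b' c' e) {q : Λ → 𝒮} {b : Λ}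
    (h : cut q (Icc 0 b) ∈ Z.outcome 0 {e}) :
    ∃ p, Z.IsRun p b c' e ∧ Z.envPart (cut p (Icc 0 c')) = Z.envPart (cut p' (Icc 0 c')) ∧
      ∀ t ∈ Icc 0 b, ∃ x, p t = Z.pair (q t, x) := by
  -- All-reetness turns an outcome of `e` into an outcome along the environment of `p'`.
  rw [← hZ.allReet e he _ ⟨_, mem_omega_iff.2 ⟨p', c', h'.reaches, rfl⟩, rfl⟩] at h
  obtain ⟨θ, ⟨hθ, ρ, ⟨hρ, henv⟩, hpart⟩, hsys⟩ := h
  obtain ⟨p₀, b₀, -, -, h₀, -, -, -, rfl⟩ := mem_theta_iff.1 hθ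
  obtain rfl := h₀.eq_of_sysPart_eq hZ.shell hsys
  obtain ⟨p, c, hp, rfl⟩ := mem_omega_iff.1 hρ
  have hpart := isPartOf_cut_iff.1 hpart
  obtain ⟨s, hs, x, hx⟩ := hZ.shell.exists_of_mem_domain hp.finish
  have h₁ : Z.envPart (cut p (Icc 0 c)) c = some x :=
    envPart_eq_some_iff.2 ⟨s, cut_eq_some_iff.2 ⟨⟨hp.le, le_rfl⟩, hx.symm⟩⟩
  obtain ⟨s', -, hs'⟩ := h'.finish_eq
  have h₂ : Z.envPart (cut p' (Icc 0 c')) c' = some e :=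
    envPart_eq_some_iff.2 ⟨s', cut_eq_some_iff.2 ⟨⟨h'.reaches.le, le_rfl⟩, hs'⟩⟩
  rw [henv] at h₁
  rw [← henv] at h₂
  -- Both end states are pairs, so each end time lies in the common domain of the equal
  -- environmental components. The end environment of `p` is then `e` as well.
  have hc : c = c' := by
    obtain ⟨_, h₁⟩ := envPart_eq_some_iff.1 h₁
    obtain ⟨_, h₂⟩ := envPart_eq_some_iff.1 h₂
    exact le_antisymm (cut_eq_some_iff.1 h₁).1.2 (cut_eq_some_iff.1 h₂).1.2
  subst hc
  rw [← henv, h₂, Option.some_inj] at h₁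
  subst h₁
  refine ⟨p, isRun_of_reaches hZ.shell hZ.eAutomaton.automataCondition he h₀
    ⟨hp.mem, hp.le, hp.start, ⟨(s, e), ⟨hs, rfl⟩, hx⟩, hp.avoid⟩ (hpart b₀ ⟨h₀.le, le_rfl⟩).1.2
    fun t ht => (hpart t ht).2.symm, henv, fun t ht => ?_⟩
  rw [(hpart t ht).2]
  exact sysPart_cut_eq_cut_iff.1 hsys t ht

/-- All outcomes of `e` have the same duration. -/
theorem duration_unique (hZ : Z.IsIdealEAutomaton) {e : ℰ} (he : e ∈ Z.envFin) {q q' : Λ → 𝒮}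
    {b b' : Λ} (hb : 0 ≤ b) (h : cut q (Icc 0 b) ∈ Z.outcome 0 {e})
    (h' : cut q' (Icc 0 b') ∈ Z.outcome 0 {e}) : b = b' := by
  obtain ⟨p, c, hp, -⟩ := hZ.exists_isRun he hb h
  obtain ⟨p', hp', henv, -⟩ := hZ.exists_isRun_envPart_eq he hp h'
  -- With equal environments, neither run can hit the final states before the other.
  exact le_antisymm (hp'.le_of_envPart_eq hZ.shell hp le_rfl fun t _ => by rw [henv])
    (hp.le_of_envPart_eq hZ.shell hp' le_rfl fun t _ => by rw [henv])

/-- If two runs have the same system component up to `m`, then, as the shell is weakly unbiased,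
the future of the first one can be followed from the state reached by the second one. -/
theorem exists_isRun_of_eqOn (hZ : Z.IsIdealEAutomaton) {p₁ p₂ : Λ → P} {b₁ b₂ c₁ c₂ : Λ}
    {e₁ e₂ : ℰ} (he₁ : e₁ ∈ Z.envFin) (he₂ : e₂ ∈ Z.envFin) (h₁ : Z.IsRun p₁ b₁ c₁ e₁)
    (h₂ : Z.IsRun p₂ b₂ c₂ e₂) {q : Λ → 𝒮} {m : Λ} (hm : 0 ≤ m) (hm₁ : m ≤ b₁) (hm₂ : m ≤ b₂)
    (hq₁ : ∀ t ∈ Icc 0 b₁, ∃ x, p₁ t = Z.pair (q t, x))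
    (hq₂ : ∀ t ∈ Icc 0 m, ∃ x, p₂ t = Z.pair (q t, x)) :
    ∃ p₃ b₃ c₃, ∃ e₃ ∈ Z.envFin, Z.IsRun p₃ b₃ c₃ e₃ ∧ m ≤ b₃ ∧ p₃ m = p₂ m ∧
      ∀ t, m ≤ t → t ≤ b₁ → t ≤ b₃ → ∃ x, p₃ t = Z.pair (q t, x) := by
  have hund := hZ.undifferentiated he₁ hm hm₁ (hZ.cut_mem_outcome he₁ h₁ hq₁) he₁ he₂ h₁ h₂
    hm₁ hm₂ (fun t ht => hq₁ t ⟨ht.1, ht.2.trans hm₁⟩) hq₂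
  obtain ⟨x₁, hx₁⟩ := hq₁ m ⟨hm, hm₁⟩
  obtain ⟨x₂, hx₂⟩ := hq₂ m ⟨hm, le_rfl⟩
  have hθ₁ := h₁.mem_theta hZ.shell he₁
  have hθ₂ := h₂.mem_theta hZ.shell he₂
  have hv₁ : cut p₁ (Icc 0 b₁) m = some (Z.pair (q m, x₁)) := cut_eq_some_iff.2 ⟨⟨hm, hm₁⟩, hx₁⟩
  have hv₂ : cut p₂ (Icc 0 b₂) m = some (Z.pair (q m, x₂)) := cut_eq_some_iff.2 ⟨⟨hm, hm₂⟩, hx₂⟩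
  rw [hx₁, hx₂] at hund
  have hIcc : ∀ {t b : Λ}, 0 ≤ t → Icc 0 b ∩ Ici t = Icc t b := by
    intro t b ht
    ext u
    exact ⟨fun h => ⟨h.2, h.1.2⟩, fun h => ⟨⟨ht.trans h.1, h.2⟩, h.1⟩⟩
  have hsys₁ : Z.sysPart ((cut p₁ (Icc 0 b₁)).restrict (Ici m)) = cut q (Icc m b₁) := by
    rw [restrict_cut, hIcc hm, sysPart_cut_eq_cut_iff]
    exact fun t ht => hq₁ t ⟨hm.trans ht.1, ht.2⟩
  obtain ⟨_, ⟨θ, hθ, t, x, rfl, hθt, rfl⟩, b₃, hd, he⟩ :=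
    hZ.eAutomaton.weaklyUnbiased m (q m) x₁ x₂ ⟨_, hθ₁, hv₁⟩ ⟨_, hθ₂, hv₂⟩ hund
      _ ⟨_, hθ₁, m, _, rfl, hv₁, hsys₁.symm⟩ b₁ (dom_cut _ _)
  obtain ⟨p₃, b₃', c₃, e₃, he₃, h₃, rfl⟩ :=
    exists_isRun_of_mem_theta hZ.shell hZ.eAutomaton.automataCondition hθ
  obtain ⟨ht, hpt⟩ := cut_eq_some_iff.1 hθt
  rw [restrict_cut, hIcc ht.1, dom_sysPart_cut hZ.shell
    fun u hu => h₃.hits.mem_interior (ht.1.trans hu.1) hu.2] at hd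
  -- The visit time of the segment supplied by weak unbiasedness is identified with `m` through its
  -- domain.
  obtain ⟨rfl, rfl⟩ := Icc_inj_of_le ht.2 hd.symm
  refine ⟨p₃, b₃, c₃, e₃, he₃, h₃, ht.2, hpt.trans hx₂.symm, fun u hmu hu₁ hu₃ => ?_⟩
  rw [restrict_cut, restrict_cut, hIcc hm, inter_eq_self_of_subset_right
    (Icc_subset_Icc_right (min_le_left _ _))] at he
  have hu := congrFun he u
  have hmem : u ∈ Icc m (min b₁ b₃) := ⟨hmu, le_min hu₁ hu₃⟩
  simp only [Seg.restrict, if_pos hmem, cut_of_mem hmem] at hu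
  obtain ⟨x, hx⟩ := sysPart_eq_some_iff.1 hu.symm
  exact ⟨x, (cut_eq_some_iff.1 hx).2⟩

/-- If paths with outcomes in `𝒪_e` and `𝒪_{e'}` agree up to `m`, then the environmental component
of every run that leads to `e'` can, up to `m`, accompany a run with the outcomes of `e`. -/
theorem accompanies_of_eqOn (hZ : Z.IsIdealEAutomaton) {e e' : ℰ} (he : e ∈ Z.envFin)
    (he' : e' ∈ Z.envFin) {q r : Λ → 𝒮} {m b b' : Λ} (hm : 0 ≤ m) (hb : 0 ≤ b)
    (hr : cut r (Icc 0 b) ∈ Z.outcome 0 {e}) (hq : cut q (Icc 0 b') ∈ Z.outcome 0 {e'})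
    (hqr : ∀ t, 0 ≤ t → t ≤ m → q t = r t) :
    (Z.outcome 0 {e'} = Z.outcome 0 {e} ∨ m < b') ∧
      ∀ p' a c, Z.IsRun p' a c e' → Z.Accompanies e m p' c := by
  -- If one outcome ends by `m`, the two agree as long as both last and their classes coincide, so
  -- `p'` accompanies itself.
  by_cases hcase : b ≤ m ∨ b' ≤ m
  · have heq : Z.outcome 0 {e'} = Z.outcome 0 {e} :=
      (hZ.eq_of_eqOn he' he hq hr fun t ht htb' htb =>
        hqr t ht (hcase.elim htb.trans htb'.trans)).2
    exact ⟨Or.inl heq, fun p' a c hp' => ⟨e', he', heq, p', a, c, hp', fun _ _ => rfl⟩⟩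
  obtain ⟨hmb, hmb'⟩ : m < b ∧ m < b' := by simpa using hcase
  refine ⟨Or.inr hmb', fun p' a c hp' => ?_⟩
  obtain ⟨p₁, h₁, henv, hq₁⟩ := hZ.exists_isRun_envPart_eq he' hp' hq
  obtain ⟨p₂, c₂, h₂, hr₂⟩ := hZ.exists_isRun he hb hr
  obtain ⟨p₃, b₃, c₃, e₃, he₃, h₃, hmb₃, hp₃, hr₃⟩ := hZ.exists_isRun_of_eqOn he he' h₂ h₁ hm
    hmb.le hmb'.le hr₂ fun t ht => by
      rw [← hqr t ht.1 ht.2]; exact hq₁ t ⟨ht.1, ht.2.trans hmb'.le⟩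
  -- This run has the environment of `p'` up to `m`. Its system component follows `r` as long as
  -- both last, so its final environment has the outcomes of `e`.
  have hw := h₁.splice hZ.shell.shell hm h₃ hp₃.symm hmb' hmb₃
  obtain ⟨w, hws⟩ := hw.hits.exists_sys hZ.shell
  refine ⟨e₃, he₃, (hZ.eq_of_eqOn he₃ he (hZ.cut_mem_outcome he₃ hw hws) hr ?_).2, _, _, _, hw, ?_⟩
  · intro t ht htb₃ htb
    obtain ⟨x, hx⟩ := hws t ⟨ht, htb₃⟩
    obtain ⟨y, hy⟩ : ∃ y, splice m p₁ p₃ t = Z.pair (r t, y) := by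
      rcases le_total t m with htm | htm
      · rw [splice_of_le _ _ htm, ← hqr t ht htm]
        exact hq₁ t ⟨ht, htm.trans hmb'.le⟩
      · rw [splice_of_ge hp₃.symm htm]
        exact hr₃ t htm htb htb₃
    rw [hx] at hy
    exact (Prod.mk.inj (Z.pair.injective hy)).1
  · intro t ht
    rw [← henv]
    have hcut : cut (splice m p₁ p₃) (Icc 0 c₃) t = cut p₁ (Icc 0 c) t := by
      by_cases h0 : 0 ≤ t
      · rw [cut_of_mem (mem_Icc.2 ⟨h0, ht.trans (hmb₃.trans h₃.le)⟩),
          cut_of_mem (mem_Icc.2 ⟨h0, ht.trans (hmb'.le.trans h₁.le)⟩), splice_of_le _ _ ht]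
      · rw [cut_of_notMem fun h => h0 h.1, cut_of_notMem fun h => h0 h.1]
    simp only [envPart, hcut]

/-- A path with an outcome in `𝒪_{e'}` that lasts longer than `m` can, at `m`, be continued by the
future of a path with outcome in `𝒪_e`, if the environmental components of runs that lead to `e`
and `e'` agree up to `m`. -/
theorem cut_splice_mem_outcome (hZ : Z.IsIdealEAutomaton) {e e' : ℰ} (he : e ∈ Z.envFin)
    (he' : e' ∈ Z.envFin) {q r : Λ → 𝒮} {m b b' : Λ} (hm : 0 ≤ m)
    (hr : cut r (Icc 0 b) ∈ Z.outcome 0 {e}) (hq : cut q (Icc 0 b') ∈ Z.outcome 0 {e'})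
    (hmb' : m < b') (hqr : q m = r m) {p p' : Λ → P} {a a' c c' : Λ} (hp : Z.IsRun p a c e)
    (hp' : Z.IsRun p' a' c' e')
    (henv : ∀ t ≤ m, Z.envPart (cut p (Icc 0 c)) t = Z.envPart (cut p' (Icc 0 c')) t) :
    cut (splice m q r) (Icc 0 b) ∈ Z.outcome 0 {e} := by
  obtain ⟨p₁, h₁, henv₁, hq₁⟩ := hZ.exists_isRun_envPart_eq he' hp' hq
  obtain ⟨p₂, h₂, henv₂, hr₂⟩ := hZ.exists_isRun_envPart_eq he hp hr
  rw [← henv₁, ← henv₂] at henv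
  have hmb : m ≤ b := h₂.le_of_envPart_eq hZ.shell h₁ hmb'.le fun t ht => (henv t ht.le).symm
  obtain ⟨x, hx⟩ := hq₁ m ⟨hm, hmb'.le⟩
  obtain ⟨y, hy⟩ := hr₂ m ⟨hm, hmb⟩
  -- The system components agree by `hqr`, the environmental ones by `henv`, so the two runs meet in
  -- the same shell state.
  have hpm : p₁ m = p₂ m := by
    have h₁x : Z.envPart (cut p₁ (Icc 0 c')) m = some x :=
      envPart_eq_some_iff.2 ⟨_, cut_eq_some_iff.2 ⟨⟨hm, hmb'.le.trans h₁.le⟩, hx⟩⟩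
    have h₂y : Z.envPart (cut p₂ (Icc 0 c)) m = some y :=
      envPart_eq_some_iff.2 ⟨_, cut_eq_some_iff.2 ⟨⟨hm, hmb.trans h₂.le⟩, hy⟩⟩
    have h := henv m le_rfl
    rw [h₁x, h₂y, Option.some_inj] at h
    rw [hx, hy, hqr, h]
  refine hZ.cut_mem_outcome he (h₁.splice hZ.shell.shell hm h₂ hpm hmb' hmb) fun t ht => ?_
  rcases le_total t m with htm | htm
  · rw [splice_of_le _ _ htm, splice_of_le _ _ htm]
    exact hq₁ t ⟨ht.1, htm.trans hmb'.le⟩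
  · rw [splice_of_ge hpm htm, splice_of_ge hqr htm]
    exact hr₂ t ht

end IsIdealEAutomaton

end ShellData

/-! ### From outcomes to the decided covering -/

namespace ShellData

variable {Λ 𝒮 ℰ P : Type*} {Z : ShellData Λ 𝒮 ℰ P} [AddCommMonoid Λ] [LinearOrder Λ]
  {S : Set (Λ → 𝒮)} {K : Set (Set (Λ → 𝒮))} {l : Λ}

/-- The outcome only depends on times from `l ≥ l'` on, where the splice equals `q`. -/
theorem splice_mem_through_outcome (hE : Z.IsEnvironmentalShell) {E : Set ℰ} {l' : Λ}
    (hl : l' ≤ l) {p q : Λ → 𝒮} (hq : q ∈ through S (Z.outcome l E)) (hpq : p l' = q l')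
    (hS : splice l' p q ∈ S) : splice l' p q ∈ through S (Z.outcome l E) := by
  obtain ⟨-, b, hb, hqb⟩ := (mem_through_outcome_iff hE).1 hq
  refine (mem_through_outcome_iff hE).2 ⟨hS, b, hb, ?_⟩
  rwa [cut_eq_cut_iff.2 fun t ht => splice_of_ge hpq (hl.trans ht.1)]

theorem isBoundedBelow_through_outcome (hE : Z.IsEnvironmentalShell) {E : Set ℰ} {l' : Λ}
    (hl : l' ≤ l) (hS : ∀ p ∈ S, ∀ q ∈ S, p l' = q l' → splice l' p q ∈ S) :
    IsBoundedBelow S (through S (Z.outcome l E)) l' :=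
  total_image_eq_concat (fun _ hq => hq.1) Subset.rfl fun p hp q hq hpq =>
    splice_mem_through_outcome hE hl hq hpq (hS p hp q hq.1 hpq)

variable [IsParameter Λ]

theorem splice_add_right (m : Λ) (p q : Λ → 𝒮) :
    (fun t => splice (m + l) p q (t + l)) = splice m (fun t => p (t + l)) (fun t => q (t + l)) := by
  funext t
  simp [splice]

theorem through_outcome_congr (hE : Z.IsEnvironmentalShell) {E E' : Set ℰ}
    (h : Z.outcome 0 E = Z.outcome 0 E') :
    through S (Z.outcome l E) = through S (Z.outcome l E') := by
  ext q
  rw [mem_through_outcome_shift_iff hE, mem_through_outcome_shift_iff hE, h]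

namespace IsIdealEAutomaton

theorem isPartition (hZ : Z.IsIdealEAutomaton) (hS : IsCovering S K)
    (hK : K = {α | ∃ e ∈ Z.envFin, α = through S (Z.outcome l {e})}) : IsPartition S K := by
  refine ⟨hS, ?_⟩
  subst hK
  rintro _ ⟨e, he, rfl⟩ _ ⟨e', he', rfl⟩ hne
  rw [disjoint_left]
  intro q hq hq'
  obtain ⟨-, b, -, hb⟩ := (mem_through_outcome_shift_iff hZ.shell).1 hq
  obtain ⟨-, b', -, hb'⟩ := (mem_through_outcome_shift_iff hZ.shell).1 hq'
  exact hne (through_outcome_congr hZ.shell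
    (hZ.eq_of_eqOn he he' hb hb' fun _ _ _ _ => rfl).2)

/-- Whether a path is decided for `e` can be read off from its restriction to `[-∞,l']`, for a
suitable `l'`. -/
theorem exists_decision_time (hZ : Z.IsIdealEAutomaton) {e : ℰ} (he : e ∈ Z.envFin) :
    ∃ l', ∀ q ∈ through S (Z.outcome l {e}), ∀ p ∈ S, (∀ t ≤ l', q t = p t) →
      p ∈ through S (Z.outcome l {e}) := by
  rcases (through S (Z.outcome l {e})).eq_empty_or_nonempty with h | ⟨r, hr⟩
  · exact ⟨0, fun q hq => by simp [h] at hq⟩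
  obtain ⟨-, b, hb, hrb⟩ := (mem_through_outcome_shift_iff hZ.shell).1 hr
  -- As `b` is the duration of all outcomes of `e`, the time `b + l` serves for every path decided
  -- for `e`.
  refine ⟨b + l, fun q hq p hp hqp => ?_⟩
  obtain ⟨-, b', -, hqb⟩ := (mem_through_outcome_shift_iff hZ.shell).1 hq
  obtain rfl := hZ.duration_unique he hb hrb hqb
  refine (mem_through_outcome_shift_iff hZ.shell).2 ⟨hp, b, hb, ?_⟩
  rwa [cut_eq_cut_iff.2 fun t ht => hqp (t + l) (by simpa using ht.2)] at hqb

theorem isWeaklyBoundedAbove (hZ : Z.IsIdealEAutomaton) {e : ℰ} (he : e ∈ Z.envFin) :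
    ∃ l', IsWeaklyBoundedAbove S (through S (Z.outcome l {e})) l' := by
  obtain ⟨l', h⟩ := hZ.exists_decision_time (S := S) (l := l) he
  refine ⟨l', Subset.antisymm (fun q hq => mem_through_of_cut_mem hq.1 ⟨q, hq, rfl⟩) ?_⟩
  rintro p ⟨hp, _, ⟨q, hq, rfl⟩, hqp⟩
  exact h q hq p hp (cut_eq_cut_iff.1 ((isPartOf_total_iff (dom_cut _ _)).1 hqp))

theorem isBoundedAbove (hZ : Z.IsIdealEAutomaton) (hS : IsDynamicSpace S) {e : ℰ}
    (he : e ∈ Z.envFin) : ∃ l', IsBoundedAbove S (through S (Z.outcome l {e})) l' := by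
  obtain ⟨l', h⟩ := hZ.exists_decision_time (S := S) (l := l) he
  refine ⟨l', total_image_eq_concat Subset.rfl (fun q hq => hq.1) fun q hq p hp hqp => ?_⟩
  exact h q hq _ (hS.2 q hq.1 p hp l' hqp) fun t ht => (splice_of_le _ _ ht).symm

/-- Along `|α[-∞,l']|`, where `α` is the set of paths decided for `e`, the decision either is the
same or has not yet been made, and the environment can still lead to the outcomes of `e`. -/
theorem accompanies_of_mem_chain (hZ : Z.IsIdealEAutomaton)
    (hK : K = {α | ∃ e ∈ Z.envFin, α = through S (Z.outcome l {e})}) {e : ℰ}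
    (he : e ∈ Z.envFin) {m : Λ} (hm : 0 ≤ m) (n : ℕ) (q : Λ → 𝒮)
    (hq : cut q (Iic (m + l)) ∈ chain {B | ∃ β ∈ K, B = cuts β (Iic (m + l))}
      (cuts (through S (Z.outcome l {e})) (Iic (m + l))) n)
    {e' : ℰ} (he' : e' ∈ Z.envFin) {b' : Λ}
    (hqb : cut (fun t => q (t + l)) (Icc 0 b') ∈ Z.outcome 0 {e'}) :
    (Z.outcome 0 {e'} = Z.outcome 0 {e} ∨ m < b') ∧
      ∀ p' a c, Z.IsRun p' a c e' → Z.Accompanies e m p' c := by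
  induction n generalizing q e' b' with
  | zero =>
    obtain ⟨r, hr, hrq⟩ := hq
    obtain ⟨-, b, hb, hrb⟩ := (mem_through_outcome_shift_iff hZ.shell).1 hr
    exact hZ.accompanies_of_eqOn he he' hm hb hrb hqb fun t _ htm =>
      (cut_eq_cut_iff.1 hrq (t + l) (by simpa using htm)).symm
  | succ n ih =>
    obtain ⟨_, ⟨_, hβ, rfl⟩, ⟨_, ⟨r, hr, rfl⟩, hrn⟩, r', hr', hrq⟩ := hq
    rw [hK] at hβ
    obtain ⟨e'', he'', rfl⟩ := hβ
    obtain ⟨-, b, hb, hrb⟩ := (mem_through_outcome_shift_iff hZ.shell).1 hr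
    obtain ⟨-, d, hd, hrd⟩ := (mem_through_outcome_shift_iff hZ.shell).1 hr'
    obtain ⟨h₁, h₂⟩ := hZ.accompanies_of_eqOn he'' he' hm hd hrd hqb fun t _ htm =>
      (cut_eq_cut_iff.1 hrq (t + l) (by simpa using htm)).symm
    constructor
    · rcases h₁ with h₁ | h₁
      · rw [h₁]
        rw [h₁] at hqb
        obtain rfl := hZ.duration_unique he'' hb hrb hqb
        exact (ih r hrn he'' hrb).1
      · exact Or.inr h₁
    · exact fun p' a c hp' => (h₂ p' a c hp').trans fun e₁ he₁ ho p b₁ c₁ hp =>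
        (ih r hrn he₁ (ho ▸ hrb)).2 p b₁ c₁ hp

/-- Only the outcome of the splice is at issue here; its membership in `S` is left to `hsplice`, as
it has different sources for dynamic sets and dynamic spaces. -/
theorem recombines (hZ : Z.IsIdealEAutomaton) (hS : IsCovering S K)
    (hK : K = {α | ∃ e ∈ Z.envFin, α = through S (Z.outcome l {e})})
    (hsplice : ∀ α ∈ K, ∀ l', ∀ q ∈ S, cut q (Iic l') ∈ coarse K α l' → ∀ r ∈ α,
      q l' = r l' → splice l' q r ∈ S) : Recombines K := by
  intro α hα l'
  have hαS : α ⊆ S := hS ▸ subset_sUnion_of_mem hα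
  rw [coarse_eq_cuts hS hα]
  refine total_image_eq_concat
    (fun q hq => ⟨hαS hq, cuts_subset_coarse K α l' ⟨q, hq, rfl⟩⟩) Subset.rfl ?_
  rintro q ⟨hq, hqc⟩ r hr hqr
  have hmem := hsplice α hα l' q hq hqc r hr hqr
  have hα' := hα
  rw [hK] at hα'
  obtain ⟨e, he, rfl⟩ := hα'
  rcases le_total l' l with hl | hl
  · exact splice_mem_through_outcome hZ.shell hl hr hqr hmem
  obtain ⟨m, hm, rfl⟩ := exists_nonneg_add_eq hl
  refine (mem_through_outcome_shift_iff hZ.shell).2 ⟨hmem, ?_⟩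
  rw [splice_add_right]
  obtain ⟨n, hn⟩ := mem_iUnion.1 hqc
  obtain ⟨β, hβ, hqβ⟩ : q ∈ ⋃₀ K := hS.symm ▸ hq
  rw [hK] at hβ
  obtain ⟨e', he', rfl⟩ := hβ
  obtain ⟨-, b', hb', hqb⟩ := (mem_through_outcome_shift_iff hZ.shell).1 hqβ
  obtain ⟨-, b, hb, hrb⟩ := (mem_through_outcome_shift_iff hZ.shell).1 hr
  obtain ⟨h₁, h₂⟩ := hZ.accompanies_of_mem_chain hK he hm n q hn he' hqb
  -- If `q` is decided by `m`, its own outcome survives in the splice and belongs to the class of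
  -- `e`. Otherwise the outcome of `r` is attached, after replacing `e` by an equivalent `e₁`
  -- reachable with the environment of a run for `q`.
  rcases le_or_gt b' m with hbm | hbm
  · refine ⟨b', hb', ?_⟩
    rw [cut_eq_cut_iff.2 fun t ht => splice_of_le _ _ (ht.2.trans hbm),
      ← h₁.resolve_right hbm.not_gt]
    exact hqb
  · obtain ⟨p', c', hp', -⟩ := hZ.exists_isRun he' hb' hqb
    obtain ⟨e₁, he₁, ho, p, a, c, hp, henv⟩ := h₂ p' b' c' hp'
    rw [← ho] at hrb ⊢
    exact ⟨b, hb, hZ.cut_splice_mem_outcome he₁ he' hm hrb hqb hbm hqr hp hp' henv⟩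

end IsIdealEAutomaton

end ShellData

end DynExp

/-! ### The theorem for dynamic sets and for dynamic spaces -/

theorem mainTheorem1 {Λ 𝒮 ℰ P : Type*} [AddCommMonoid Λ] [LinearOrder Λ]
    [DynExp.IsParameter Λ] (Z : DynExp.ShellData Λ 𝒮 ℰ P) (hZ : Z.IsIdealEAutomaton)
    (S : Set (Λ → 𝒮)) (K : Set (Set (Λ → 𝒮))) (hK : DynExp.IsCovering S K) :
    (DynExp.IsDynamicSet S → Z.Decides S K → DynExp.IsIdealPartition S K) ∧
      (DynExp.IsDynamicSpace S → Z.DecidesSpace S K → DynExp.IsSpaceIdealPartition S K) := by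
  constructor
  · rintro - ⟨l, -, hun, hKl⟩
    have hbelow : ∀ l' ≤ l, ∀ p ∈ S, ∀ q ∈ S, p l' = q l' → DynExp.splice l' p q ∈ S :=
      fun l' hl p hp q hq hpq =>
        DynExp.splice_mem_of_isBoundedBelow (hun.below l' hl) hp hq hpq
    refine ⟨hZ.isPartition hK hKl, ⟨l, ?_⟩, ?_, hZ.recombines hK hKl ?_⟩
    · intro α hα l' hl
      rw [hKl] at hα
      obtain ⟨e, -, rfl⟩ := hα
      exact DynExp.ShellData.isBoundedBelow_through_outcome hZ.shell hl (hbelow l' hl)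
    · intro α hα
      rw [hKl] at hα
      obtain ⟨e, he, rfl⟩ := hα
      exact hZ.isWeaklyBoundedAbove he
    · intro α hα l' q hq hqc r hr hqr
      have hrS : r ∈ S := hK ▸ subset_sUnion_of_mem hα hr
      -- Up to `l`, splicing stays in `S` because `S` is strongly bounded from below; after `l`,
      -- unbiasedness applies, as both paths extend members of the coarse past.
      rcases le_or_gt l' l with hl | hl
      · exact hbelow l' hl q hq r hrS hqr
      · exact hun.splice_mem α hα l' hl q (DynExp.mem_through_of_cut_mem hq hqc) r
          (DynExp.mem_through_of_cut_mem hrS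
            (DynExp.cuts_subset_coarse K α l' ⟨r, hr, rfl⟩)) hqr
  · rintro hS ⟨l, hKl⟩
    refine ⟨hZ.isPartition hK hKl, ⟨l, ?_⟩, ?_, hZ.recombines hK hKl ?_⟩
    · intro α hα
      rw [hKl] at hα
      obtain ⟨e, -, rfl⟩ := hα
      exact DynExp.ShellData.isBoundedBelow_through_outcome hZ.shell le_rfl
        fun p hp q hq hpq => hS.2 p hp q hq l hpq
    · intro α hα
      rw [hKl] at hα
      obtain ⟨e, he, rfl⟩ := hα
      exact hZ.isBoundedAbove hS he
    · intro α hα l' q hq _ r hr hqr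
      have hrS : r ∈ S := hK ▸ subset_sUnion_of_mem hα hr
      exact hS.2 q hq r hrS l' hqr
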